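/- Let $d\in\{2,3\}$, $L>0$, $\Omega=(0,L)^d$. "Periodic" means $L$-periodic in every coordinate direction on $\mathbb R^d$, and functions are identified when they agree almost everywhere. Let $H^1_{\rm per}(\Omega)$ be the space of periodic functions $\phi\in L^2(\Omega)$ on $\mathbb R^d$ that have a weak gradient $\nabla\phi$ on $\mathbb R^d$ with $\nabla\phi\in L^2(\Omega,\mathbb R^d)$, and let $\mathring H^1_{\rm per}(\Omega)$ be the set of $\phi\in H^1_{\rm per}(\Omega)$ with $\int_\Omega\phi\,dx=0$. Let $H_{\rm per}({\rm div},\Omega)$ be the closure of the set of restrictions to $\Omega$ of periodic $C^1$ vector fields in $H({\rm div},\Omega)=\{D\in L^2(\Omega,\mathbb R^d):\nabla\cdot D\in L^2(\Omega)\}$ (weak divergence in $\Omega$) with the norm $\|D\|_{L^2(\Omega)}+\|\nabla\cdot D\|_{L^2(\Omega)}$. Let $\varepsilon$ be a measurable periodic function on $\mathbb R^d$ such that $0<\varepsilon_{\min}\le\varepsilon(x)\le\varepsilon_{\max}$ for almost every $x$, with constants $\varepsilon_{\min},\varepsilon_{\max}\in\mathbb R$, and let $\rho$ be a periodic function with $\rho\in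 L^2(\Omega)$ and $\int_\Omega\rho\,dx=0$. Put $S_\rho=\{D\in H_{\rm per}({\rm div},\Omega):\nabla\cdot D=\rho\text{ in }\Omega\}$, $S_0=\{D\in H_{\rm per}({\rm div},\Omega):\nabla\cdot D=0\text{ in }\Omega\}$, and $$I[\phi]=\int_\Omega\Big(\frac{\varepsilon}{2}|\nabla\phi|^2-\rho\,\phi\Big)dx\quad(\phi\in H^1_{\rm per}(\Omega)),\qquad F[D]=\int_\Omega\frac1{2\varepsilon}|D|^2\,dx\quad(D\in S_\rho).$$ (1) There exists a unique $\phi_{\min}\in\mathring H^1_{\rm per}(\Omega)$ such that $I[\phi_{\min}]=\min_{\phi\in\mathring H^1_{\rm per}(\Omega)}I[\phi]$. Moreover, $\phi_{\min}$ is the unique weak solution in $\mathring H^1_{\rm per}(\Omega)$ of Poisson's equation $\nabla\cdot\varepsilon\nabla\phi=-\rho$, i.e. the unique $\phi\in\mathring H^1_{\rm per}(\Omega)$ with $$\int_\Omega\varepsilon\nabla\phi\cdot\nabla\xi\,dx=\int_\Omega\rho\,\xi\,dx\qquad\text{for all }\xi\in\mathring H^1_{\rm per}(\Omega).$$ (2)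 There exists a unique $D_{\min}\in S_\rho$ such that $F[D_{\min}]=\min_{D\in S_\rho}F[D]$. Moreover, $D_{\min}$ is characterized by orthogonality: a field $D\in S_\rho$ minimizes $F$ over $S_\rho$ if and only if $$\int_\Omega\frac1\varepsilon\,D\cdot\tilde D\,dx=0\qquad\text{for all }\tilde D\in S_0.$$ (3) $D_{\min}=-\varepsilon\nabla\phi_{\min}$. -/

import Mathlib

open MeasureTheory Filter
open scoped Topology ContDiff

namespace PoissonEnergy

/-- The Euclidean space `ℝ^d`. -/
abbrev Space (d : ℕ) : Type := EuclideanSpace ℝ (Fin d)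

/-- The open cube `Ω = (0, L)^d`. -/
def cube (d : ℕ) (L : ℝ) : Set (Space d) := {x | ∀ i, x i ∈ Set.Ioo 0 L}

/-- `u : ℝ^d → β` is periodic with period `L` in every coordinate direction. -/
def IsPeriodic {d : ℕ} {β : Type} (L : ℝ) (u : Space d → β) : Prop :=
  ∀ (x : Space d) (i : Fin d), u (x + EuclideanSpace.single i L) = u x

/-- `L^p_per(Ω)`: periodic functions on `ℝ^d` whose restriction to `Ω` is in `L^p(Ω)`.
Functions that agree almost everywhere are not identified by the type; uniqueness statements
are therefore made up to almost everywhere equality. -/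
def LpPer (d : ℕ) (L : ℝ) (p : ENNReal) : Set (Space d → ℝ) :=
  {u | IsPeriodic L u ∧ MemLp u p (volume.restrict (cube d L))}

/-- The elements of `L^p_per(Ω)` whose average over `Ω` is zero. -/
def LpPerZero (d : ℕ) (L : ℝ) (p : ENNReal) : Set (Space d → ℝ) :=
  {u | u ∈ LpPer d L p ∧ ⨍ x in cube d L, u x = 0}

/-- Smooth test functions compactly supported in the open set `U`. -/
def IsTestFunction {d : ℕ} (U : Set (Space d)) (ψ : Space d → ℝ) : Prop :=
  ContDiff ℝ ∞ ψ ∧ HasCompactSupport ψ ∧ tsupport ψ ⊆ U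

/-- `g` is the weak (distributional) gradient of `u` on all of `ℝ^d`. -/
def IsWeakGradient {d : ℕ} (u : Space d → ℝ) (g : Space d → Space d) : Prop :=
  LocallyIntegrable u ∧ LocallyIntegrable g ∧
    ∀ ψ : Space d → ℝ, IsTestFunction Set.univ ψ → ∀ i : Fin d,
      ∫ x, u x * gradient ψ x i = -∫ x, g x i * ψ x

open Classical in
/-- The weak gradient `∇u` (a representative of its almost everywhere class; `0` if `u` has none). -/
noncomputable def weakGrad {d : ℕ} (u : Space d → ℝ) : Space d → Space d :=
  if h : ∃ g, IsWeakGradient u g then h.choose else 0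

/-- `H^1_per(Ω)`: periodic functions on `ℝ^d` in `L^2(Ω)` whose weak gradient on `ℝ^d` exists and
is in `L^2(Ω)`. The gradient is taken on all of `ℝ^d`, so that the traces of `u` on opposite
faces of the cube agree. -/
def H1Per (d : ℕ) (L : ℝ) : Set (Space d → ℝ) :=
  {u | u ∈ LpPer d L 2 ∧
    ∃ g, IsWeakGradient u g ∧ MemLp g 2 (volume.restrict (cube d L))}

/-- The elements of `H^1_per(Ω)` whose average over `Ω` is zero. -/
def H1PerZero (d : ℕ) (L : ℝ) : Set (Space d → ℝ) :=
  {u | u ∈ H1Per d L ∧ ⨍ x in cube d L, u x = 0}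

/-- `g` is the weak divergence of `D` in the open set `U`. -/
def IsWeakDivOn {d : ℕ} (U : Set (Space d)) (D : Space d → Space d) (g : Space d → ℝ) : Prop :=
  LocallyIntegrableOn D U ∧ LocallyIntegrableOn g U ∧
    ∀ ψ : Space d → ℝ, IsTestFunction U ψ →
      ∫ x in U, inner ℝ (D x) (gradient ψ x) = -∫ x in U, g x * ψ x

/-- The classical divergence of a vector field. -/
noncomputable def classicalDiv {d : ℕ} (V : Space d → Space d) (x : Space d) : ℝ :=
  ∑ i, fderiv ℝ V x (EuclideanSpace.single i 1) i

/-- `H_per(div, Ω)`: the vector fields `D ∈ L^2(Ω, ℝ^d)` with weak divergence in `L^2(Ω)` that are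
limits, in the norm `‖D‖_{L^2} + ‖∇·D‖_{L^2}` of `H(div, Ω)`, of restrictions to `Ω` of periodic
`C^1` vector fields. Only the values of `D` in `Ω` matter. -/
def HDivPer (d : ℕ) (L : ℝ) : Set (Space d → Space d) :=
  {D | MemLp D 2 (volume.restrict (cube d L)) ∧
    ∃ g : Space d → ℝ, MemLp g 2 (volume.restrict (cube d L)) ∧ IsWeakDivOn (cube d L) D g ∧
      ∃ V : ℕ → Space d → Space d,
        (∀ k, ContDiff ℝ 1 (V k) ∧ IsPeriodic L (V k)) ∧
        Tendsto (fun k => eLpNorm (fun x => V k x - D x) 2 (volume.restrict (cube d L))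
          + eLpNorm (fun x => classicalDiv (V k) x - g x) 2 (volume.restrict (cube d L)))
          atTop (𝓝 0)}

/-- The Gauss-law set `S_ρ = {D ∈ H_per(div, Ω) : ∇·D = ρ in Ω}`. -/
def gaussSet (d : ℕ) (L : ℝ) (ρ : Space d → ℝ) : Set (Space d → Space d) :=
  {D | D ∈ HDivPer d L ∧ IsWeakDivOn (cube d L) D ρ}

/-- `I[φ] = ∫_Ω (ε/2 |∇φ|² - ρ φ) dx`. -/
noncomputable def dirichletEnergy {d : ℕ} (L : ℝ) (ε ρ φ : Space d → ℝ) : ℝ :=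
  ∫ x in cube d L, (ε x / 2 * ‖weakGrad φ x‖ ^ 2 - ρ x * φ x)

/-- `F[D] = ∫_Ω 1/(2ε) |D|² dx`. -/
noncomputable def poissonEnergy {d : ℕ} (L : ℝ) (ε : Space d → ℝ) (D : Space d → Space d) : ℝ :=
  ∫ x in cube d L, 1 / (2 * ε x) * ‖D x‖ ^ 2

/-- `φ` is a weak solution in the zero-average part of `H^1_per(Ω)` of `∇·ε∇φ = -ρ`. -/
def IsWeakSolution {d : ℕ} (L : ℝ) (ε ρ φ : Space d → ℝ) : Prop :=
  φ ∈ H1PerZero d L ∧ ∀ ξ ∈ H1PerZero d L,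
    ∫ x in cube d L, ε x * inner ℝ (weakGrad φ x) (weakGrad ξ x) = ∫ x in cube d L, ρ x * ξ x

end PoissonEnergy

open PoissonEnergy

/-! On the cube everything becomes a statement about Fourier coefficients. The gradient is the
multiplier `derivSymbol`, `2πi k_j / L`, and the two function spaces are described by linear
relations between coefficients. For periodic square-integrable `u`, having the weak gradient `g` in
`L²(Ω)` means `HasFourierGrad L u g` (`H1PerZero_props`, `HasFourierGrad.mem_H1PerZero`). A field of
class `L²` lies in the Gauss-law set of `r ∈ L²` exactly when `HasFourierDiv L D r` holds
(`mem_gaussSet_iff`). No trace theory is needed: periodic boundary conditions are contained in the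
use of periodic characters. Since the symbol is purely imaginary, Parseval gives Green's identity `∫
∇u·D = -∫ u ∇·D` (`HasFourierGrad.setIntegral_inner`); since a nonzero integer vector has length at
least one, it also gives Poincaré's inequality with constant `(2π/L)²`.

For (1), the pairs `(u, ∇u)` with zero mean form a closed subspace of `L² × L²`, on which `∫ ε
∇u·∇v` is coercive by Poincaré, so Lax–Milgram yields a weak solution `φ` (`exists_weak_solution`).
Completing the square gives `I[φ'] = I[φ] + ½ ∫ ε |∇(φ' - φ)|²`, hence minimality; equality forces a
zero gradient, and Poincaré then forces `φ' = φ`.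

For (2) and (3), no separate existence argument is made for `D`. Testing the weak equation with
cosines and sines shows that `-ε∇φ` has divergence `ρ`, the zero mode being the condition that `ρ`
has zero mean. Green's identity makes `-ε∇φ` orthogonal to divergence-free fields in the weight
`1/ε`. Orthogonality is equivalent to minimality because `F` is quadratic on an affine space with
direction `S_0`, and it determines the field uniquely. So `D_min` is `-ε∇φ`. -/

namespace PoissonEnergy

variable {d : ℕ} {L : ℝ}

/-! ### Comparison of the cube with the unit torus. -/

section Torus

attribute [local instance] instMeasureSpaceUnitAddCircle
attribute [local instance] instIsAddHaarMeasureUnitAddCircleVolume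
attribute [local instance] instIsProbabilityMeasureUnitAddCircleVolume

/-- The section `t ↦ L t` of the quotient map from `ℝ^d` to the unit torus with values in the
half-open cube `(0, L]^d`. -/
noncomputable def torusSection (d : ℕ) (L : ℝ) (t : UnitAddTorus (Fin d)) : Space d :=
  L • WithLp.toLp 2 (UnitAddTorus.measurableEquivPiIoc (fun _ => 0) t : Fin d → ℝ)

theorem cube_eq_smul_preimage (hL : 0 < L) :
    (fun x : Space d => L • x) ⁻¹' cube d L = cube d 1 := by
  ext x
  simp only [cube, Set.mem_preimage, Set.mem_ofPred_eq, PiLp.smul_apply, smul_eq_mul, Set.mem_Ioo]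
  refine forall_congr' fun i => ?_
  rw [mul_pos_iff_of_pos_left hL]
  constructor
  · rintro ⟨h1, h2⟩; exact ⟨h1, by nlinarith⟩
  · rintro ⟨h1, h2⟩; exact ⟨h1, by nlinarith⟩

theorem isOpen_cube : IsOpen (cube d L) := by
  have : cube d L = ⋂ i : Fin d, (fun x : Space d => x i) ⁻¹' Set.Ioo 0 L := by
    ext x; simp [cube]
  rw [this]
  exact isOpen_iInter_of_finite fun i => isOpen_Ioo.preimage (by fun_prop)

theorem measurableSet_cube : MeasurableSet (cube d L) := isOpen_cube.measurableSet

/-- The torus has total mass one and the cube has volume `L ^ d`, whence the normalizing factor. The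
section takes values in a half-open cube, which differs from the open one by a null set. -/
theorem measurePreserving_torusSection (hL : 0 < L) :
    MeasurePreserving (torusSection d L) volume
      (ENNReal.ofReal (L ^ d)⁻¹ • volume.restrict (cube d L)) := by
  have h1 := UnitAddTorus.measurePreserving_equivPiIoc (d := Fin d) (fun _ => 0)
  set S : Set (Fin d → ℝ) := {x | ∀ i, x i ∈ Set.Ioc (0 : ℝ) (0 + 1)} with hS
  have hSm : MeasurableSet S := MeasurableSet.univ_pi' (fun i => measurableSet_Ioc)
  have h2 : MeasurePreserving (Subtype.val : S → Fin d → ℝ) (Measure.comap Subtype.val volume)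
      (volume.restrict (WithLp.toLp 2 ⁻¹' cube d 1)) := by
    refine ⟨measurable_subtype_coe, ?_⟩
    rw [map_comap_subtype_coe hSm]
    refine Measure.restrict_congr_set ?_
    have : WithLp.toLp 2 ⁻¹' cube d 1 = Set.pi Set.univ fun _ : Fin d => Set.Ioo (0 : ℝ) 1 := by
      ext x; simp [cube]
    have h' : S = Set.pi Set.univ fun _ : Fin d => Set.Ioc (0 : ℝ) 1 := by
      ext x; simp [hS]
    rw [this, h']
    exact (Measure.univ_pi_Ioc_ae_eq_Icc (f := fun _ => (0 : ℝ)) (g := fun _ => 1)).trans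
      (Measure.univ_pi_Ioo_ae_eq_Icc (f := fun _ => (0 : ℝ)) (g := fun _ => 1)).symm
  have h3 : MeasurePreserving (WithLp.toLp 2 : (Fin d → ℝ) → Space d)
      (volume.restrict (WithLp.toLp 2 ⁻¹' cube d 1)) (volume.restrict (cube d 1)) :=
    (PiLp.volume_preserving_toLp (Fin d)).restrict_preimage measurableSet_cube
  have h4 : MeasurePreserving (fun x : Space d => L • x) (volume.restrict (cube d 1))
      (ENNReal.ofReal (L ^ d)⁻¹ • volume.restrict (cube d L)) := by
    refine ⟨measurable_const_smul L, ?_⟩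
    rw [← cube_eq_smul_preimage hL, ← Measure.restrict_map (measurable_const_smul L)
      measurableSet_cube, Measure.map_addHaar_smul _ hL.ne', Measure.restrict_smul]
    simp [abs_of_pos (pow_pos hL d)]
  exact h4.comp (h3.comp (h2.comp h1))

/-- The character `x ↦ exp (2πi k·x / L)`. -/
noncomputable def character (L : ℝ) (k : Fin d → ℤ) (x : Space d) : ℂ :=
  Complex.exp (Complex.I * (2 * Real.pi / L * ∑ j, (k j : ℝ) * x j : ℝ))

theorem character_torusSection (hL : 0 < L) (k : Fin d → ℤ) (t : UnitAddTorus (Fin d)) :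
    character L k (torusSection d L t) = UnitAddTorus.mFourier k t := by
  have ht : ∀ j, ((UnitAddTorus.measurableEquivPiIoc (fun _ => 0) t : Fin d → ℝ) j
      : UnitAddCircle) = t j := fun j =>
    congrFun ((UnitAddTorus.measurableEquivPiIoc (fun _ => (0 : ℝ))).symm_apply_apply t) j
  simp only [UnitAddTorus.mFourier, ContinuousMap.coe_mk, character]
  conv_rhs => enter [2, j]; rw [← ht j, fourier_coe_apply]
  rw [← Complex.exp_sum]
  congr 1
  push_cast
  rw [Finset.mul_sum, Finset.mul_sum]
  refine Finset.sum_congr rfl fun j _ => ?_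
  simp only [torusSection, PiLp.smul_apply, smul_eq_mul]
  have : (L : ℂ) ≠ 0 := by exact_mod_cast hL.ne'
  push_cast
  field_simp

end Torus

/-! ### Characters and Fourier coefficients on the cube. -/

section Characters

theorem continuous_character (k : Fin d → ℤ) : Continuous (character (d := d) L k) := by
  unfold character; fun_prop

theorem norm_character (k : Fin d → ℤ) (x : Space d) : ‖character L k x‖ = 1 := by
  rw [character, mul_comm, Complex.norm_exp_ofReal_mul_I]

theorem character_neg (k : Fin d → ℤ) (x : Space d) :
    character L (-k) x = (starRingEnd ℂ) (character L k x) := by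
  unfold character
  rw [← Complex.exp_conj, map_mul, Complex.conj_I, Complex.conj_ofReal]
  congr 1
  push_cast
  simp

/-- The (unnormalized) Fourier coefficients over the cube `(0, L)^d`. -/
noncomputable def fourierCoef (L : ℝ) (f : Space d → ℝ) (k : Fin d → ℤ) : ℂ :=
  ∫ x in cube d L, character L (-k) x * (f x : ℂ)

end Characters

/-! ### Parseval's identity and `L²` convergence of Fourier series. -/

section Parseval

attribute [local instance] instMeasureSpaceUnitAddCircle
attribute [local instance] instIsAddHaarMeasureUnitAddCircleVolume
attribute [local instance] instIsProbabilityMeasureUnitAddCircleVolume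

theorem integral_torusSection (hL : 0 < L) {F : Space d → ℂ}
    (hF : AEStronglyMeasurable F (volume.restrict (cube d L))) :
    ∫ t, F (torusSection d L t) = ((L ^ d)⁻¹ : ℝ) * ∫ x in cube d L, F x := by
  have h := measurePreserving_torusSection (d := d) hL
  rw [← integral_map (f := F) h.measurable.aemeasurable, h.map_eq, integral_smul_measure,
    ENNReal.toReal_ofReal (by positivity), Complex.real_smul]
  rw [h.map_eq]
  exact hF.smul_measure _

theorem memLp_comp_torusSection (hL : 0 < L) {f : Space d → ℝ}
    (hf : MemLp f 2 (volume.restrict (cube d L))) :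
    MemLp (fun t => (f (torusSection d L t) : ℂ)) 2 volume :=
  ((hf.ofReal (K := ℂ)).smul_measure ENNReal.ofReal_ne_top).comp_measurePreserving
    (measurePreserving_torusSection hL)

theorem mFourierCoeff_torusSection (hL : 0 < L) {f : Space d → ℝ}
    (hf : MemLp f 2 (volume.restrict (cube d L))) (k : Fin d → ℤ) :
    UnitAddTorus.mFourierCoeff ((memLp_comp_torusSection hL hf).toLp _) k
      = ((L ^ d)⁻¹ : ℝ) * fourierCoef L f k := by
  rw [fourierCoef, ← integral_torusSection hL, UnitAddTorus.mFourierCoeff]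
  · refine integral_congr_ae ?_
    filter_upwards [(memLp_comp_torusSection hL hf).coeFn_toLp] with t ht
    rw [ht, smul_eq_mul, character_torusSection hL]
  · exact (continuous_character _).aestronglyMeasurable.mul
      (hf.ofReal (K := ℂ)).aestronglyMeasurable

/-- Parseval on the torus, rescaled: each unnormalized coefficient is `L ^ d` times the torus
coefficient and the integral also scales by `L ^ d`, which leaves a single factor `L ^ d` on the
right. -/
theorem hasSum_fourierCoef_mul (hL : 0 < L) {f h : Space d → ℝ}
    (hf : MemLp f 2 (volume.restrict (cube d L))) (hh : MemLp h 2 (volume.restrict (cube d L))) :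
    HasSum (fun k => (starRingEnd ℂ) (fourierCoef L f k) * fourierCoef L h k)
      ((L ^ d * ∫ x in cube d L, f x * h x : ℝ) : ℂ) := by
  have key := UnitAddTorus.hasSum_prod_mFourierCoeff ((memLp_comp_torusSection hL hf).toLp _)
    ((memLp_comp_torusSection hL hh).toLp _)
  have hint : ∫ t, (starRingEnd ℂ) ((memLp_comp_torusSection hL hf).toLp _ t) *
      ((memLp_comp_torusSection hL hh).toLp _ t) =
      ((L ^ d)⁻¹ : ℝ) * ∫ x in cube d L, ((f x * h x : ℝ) : ℂ) := by
    rw [← integral_torusSection hL]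
    · refine integral_congr_ae ?_
      filter_upwards [(memLp_comp_torusSection hL hf).coeFn_toLp,
        (memLp_comp_torusSection hL hh).coeFn_toLp] with t h1 h2
      rw [h1, h2, Complex.conj_ofReal]
      push_cast; rfl
    · exact Complex.continuous_ofReal.comp_aestronglyMeasurable (hf.1.mul hh.1)
  rw [hint] at key
  have hL' : (L : ℂ) ^ d ≠ 0 := by exact_mod_cast (pow_pos hL d).ne'
  have e1 : (fun k => (starRingEnd ℂ) (fourierCoef L f k) * fourierCoef L h k) = fun k =>
      (((L ^ d) ^ 2 : ℝ) : ℂ) * ((starRingEnd ℂ)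
        (UnitAddTorus.mFourierCoeff ((memLp_comp_torusSection hL hf).toLp _) k) *
        UnitAddTorus.mFourierCoeff ((memLp_comp_torusSection hL hh).toLp _) k) := by
    ext k
    rw [mFourierCoeff_torusSection hL hf, mFourierCoeff_torusSection hL hh, map_mul,
      Complex.conj_ofReal]
    push_cast
    field_simp
  have e2 : ((L ^ d * ∫ x in cube d L, f x * h x : ℝ) : ℂ) = (((L ^ d) ^ 2 : ℝ) : ℂ) *
      (((L ^ d)⁻¹ : ℝ) * ∫ x in cube d L, ((f x * h x : ℝ) : ℂ)) := by
    rw [integral_complex_ofReal]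
    push_cast
    field_simp
  rw [e1, e2]
  exact key.mul_left _

/-- The partial sum of the Fourier series of `f` over the finite set `s` of frequencies. -/
noncomputable def fourierPartialSum (L : ℝ) (f : Space d → ℝ) (s : Finset (Fin d → ℤ))
    (x : Space d) : ℝ :=
  (L ^ d)⁻¹ * ∑ k ∈ s, (fourierCoef L f k * character L k x).re

/-- Since `f` is real, taking real parts of the complex partial sums can only decrease the error.
The finite sets of frequencies therefore need not be symmetric under `k ↦ -k`. -/
theorem tendsto_fourierPartialSum (hL : 0 < L) {f : Space d → ℝ}
    (hf : MemLp f 2 (volume.restrict (cube d L))) :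
    Tendsto (fun s => eLpNorm (fun x => fourierPartialSum L f s x - f x) 2
      (volume.restrict (cube d L))) atTop (𝓝 0) := by
  have key := UnitAddTorus.hasSum_mFourier_series_L2 ((memLp_comp_torusSection hL hf).toLp _)
  rw [HasSum, SummationFilter.unconditional_filter, Lp.tendsto_Lp_iff_tendsto_eLpNorm'] at key
  have hmp := measurePreserving_torusSection (d := d) hL
  set c := ENNReal.ofReal (L ^ d)⁻¹ with hc
  have hc0 : c ≠ 0 := by
    rw [hc]; exact (ENNReal.ofReal_pos.mpr (by positivity)).ne'
  -- Removing the factor `c` from the measure costs `c⁻¹ ^ (1/2)` in the `L²` norm, a constant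
  -- independent of `s`.
  have hle : ∀ s : Finset (Fin d → ℤ), eLpNorm (fun x => fourierPartialSum L f s x - f x) 2
      (volume.restrict (cube d L)) ≤ c⁻¹ ^ (1 / 2 : ENNReal).toReal * eLpNorm
        (((∑ k ∈ s, UnitAddTorus.mFourierCoeff ((memLp_comp_torusSection hL hf).toLp _) k •
          UnitAddTorus.mFourierLp 2 k : Lp ℂ 2 (volume : Measure (UnitAddTorus (Fin d)))) :
          UnitAddTorus (Fin d) → ℂ) -
          ((memLp_comp_torusSection hL hf).toLp _ : UnitAddTorus (Fin d) → ℂ)) 2 volume := by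
    intro s
    have hμ : volume.restrict (cube d L) = c⁻¹ • (c • volume.restrict (cube d L)) := by
      rw [smul_smul, ENNReal.inv_mul_cancel hc0 ENNReal.ofReal_ne_top, one_smul]
    set G : Space d → ℂ := fun x =>
      ∑ k ∈ s, ((L ^ d)⁻¹ : ℝ) * fourierCoef L f k * character L k x - (f x : ℂ) with hG
    have hGm : AEStronglyMeasurable G (c • volume.restrict (cube d L)) := by
      refine AEStronglyMeasurable.smul_measure ?_ _
      refine AEStronglyMeasurable.sub ?_ (hf.ofReal (K := ℂ)).aestronglyMeasurable
      refine Continuous.aestronglyMeasurable ?_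
      exact continuous_finsetSum _ fun k _ => continuous_const.mul (continuous_character k)
    have h1 : eLpNorm (((∑ k ∈ s, UnitAddTorus.mFourierCoeff
          ((memLp_comp_torusSection hL hf).toLp _) k •
          UnitAddTorus.mFourierLp 2 k : Lp ℂ 2 (volume : Measure (UnitAddTorus (Fin d)))) :
          UnitAddTorus (Fin d) → ℂ) -
          ((memLp_comp_torusSection hL hf).toLp _ : UnitAddTorus (Fin d) → ℂ)) 2 volume
        = eLpNorm G 2 (c • volume.restrict (cube d L)) := by
      rw [← eLpNorm_comp_measurePreserving hGm hmp]
      refine eLpNorm_congr_ae ?_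
      have hs : (↑(∑ k ∈ s, UnitAddTorus.mFourierCoeff
          ((memLp_comp_torusSection hL hf).toLp _) k •
          UnitAddTorus.mFourierLp 2 k : Lp ℂ 2 (volume : Measure (UnitAddTorus (Fin d)))) :
            UnitAddTorus (Fin d) → ℂ) =ᵐ[volume] fun t => ∑ k ∈ s, ((L ^ d)⁻¹ : ℝ) *
            fourierCoef L f k * UnitAddTorus.mFourier k t := by
        have h2 : ∀ k, (↑(UnitAddTorus.mFourierCoeff
          ((memLp_comp_torusSection hL hf).toLp _) k •
          UnitAddTorus.mFourierLp 2 k : Lp ℂ 2 (volume : Measure (UnitAddTorus (Fin d)))) :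
            UnitAddTorus (Fin d) → ℂ) =ᵐ[volume] fun t => ((L ^ d)⁻¹ : ℝ) *
            fourierCoef L f k * UnitAddTorus.mFourier k t := by
          intro k
          filter_upwards [Lp.coeFn_smul (UnitAddTorus.mFourierCoeff
            ((memLp_comp_torusSection hL hf).toLp _) k) (UnitAddTorus.mFourierLp 2 k),
            UnitAddTorus.coeFn_mFourierLp 2 k] with t ht ht'
          rw [ht, Pi.smul_apply, ht', mFourierCoeff_torusSection hL hf, smul_eq_mul]
        filter_upwards [Lp.coeFn_fun_finsetSum s (fun k => UnitAddTorus.mFourierCoeff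
          ((memLp_comp_torusSection hL hf).toLp _) k •
          UnitAddTorus.mFourierLp 2 k), ae_all_iff.mpr h2] with t ht ht'
        rw [ht]
        exact Finset.sum_congr rfl fun k _ => ht' k
      filter_upwards [hs, (memLp_comp_torusSection hL hf).coeFn_toLp] with t h1 h2
      rw [Pi.sub_apply, h1, h2]
      simp only [hG, Function.comp, character_torusSection hL]
    rw [h1]
    conv_lhs => rw [hμ]
    rw [eLpNorm_smul_measure_of_ne_zero (by simp [hc])]
    rw [smul_eq_mul]
    gcongr
    refine eLpNorm_mono fun x => ?_
    have : fourierPartialSum L f s x - f x = (G x).re := by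
      simp only [hG, fourierPartialSum, Complex.sub_re, Complex.re_sum, Complex.ofReal_re,
        Finset.mul_sum, mul_assoc, Complex.re_ofReal_mul]
    rw [this]
    exact Complex.abs_re_le_norm _
  refine tendsto_of_tendsto_of_tendsto_of_le_of_le tendsto_const_nhds ?_ (fun _ => zero_le) hle
  simpa using ENNReal.Tendsto.const_mul key
    (Or.inr (by simp [hc0] : c⁻¹ ^ (1 / 2 : ENNReal).toReal ≠ ⊤))

end Parseval

/-! ### Tiling of space by lattice translates of the cube. -/

section Lattice

/-- The element `L n` of the period lattice. -/
noncomputable def latticeVec (L : ℝ) (n : Fin d → ℤ) : Space d :=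
  WithLp.toLp 2 fun i => L * n i

@[simp]
theorem latticeVec_apply (n : Fin d → ℤ) (i : Fin d) : latticeVec L n i = L * n i := rfl

theorem latticeVec_eq_sum (n : Fin d → ℤ) :
    latticeVec L n = ∑ i, n i • EuclideanSpace.single i L := by
  ext j
  simp [Pi.single_apply, mul_comm]

theorem IsPeriodic.add_latticeVec {β : Type} {u : Space d → β} (hu : IsPeriodic L u)
    (n : Fin d → ℤ) (x : Space d) : u (x + latticeVec L n) = u x := by
  have h : ∀ s : Finset (Fin d),
      Function.Periodic u (∑ i ∈ s, n i • EuclideanSpace.single i L) := by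
    intro s
    induction s using Finset.induction_on with
    | empty => intro x; simp
    | insert i s hi ih =>
      rw [Finset.sum_insert hi]
      exact (Function.Periodic.zsmul (fun x => hu x i) (n i)).add_period ih
  rw [latticeVec_eq_sum]
  exact h Finset.univ x

/-- Invariance under the period lattice, up to null sets. -/
def AEPeriodic {E : Type*} (L : ℝ) (f : Space d → E) : Prop :=
  ∀ n : Fin d → ℤ, ∀ᵐ x, f (x + latticeVec L n) = f x

theorem IsPeriodic.aePeriodic {β : Type} {u : Space d → β} (hu : IsPeriodic L u) :
    AEPeriodic L u :=
  fun n => Eventually.of_forall (hu.add_latticeVec n)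

theorem AEPeriodic.comp {E F : Type*} {f : Space d → E} (hf : AEPeriodic L f) (φ : E → F) :
    AEPeriodic L fun x => φ (f x) := by
  intro n
  filter_upwards [hf n] with x hx
  rw [hx]

theorem AEPeriodic.comp₂ {E F G : Type*} {f : Space d → E} {g : Space d → F}
    (hf : AEPeriodic L f) (hg : AEPeriodic L g) (φ : E → F → G) :
    AEPeriodic L fun x => φ (f x) (g x) := by
  intro n
  filter_upwards [hf n, hg n] with x hx hx'
  rw [hx, hx']

/-- The half-open translates of the cube by lattice vectors. -/
def tile (d : ℕ) (L : ℝ) (n : Fin d → ℤ) : Set (Space d) :=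
  {x | ∀ i, x i ∈ Set.Ico (L * n i) (L * n i + L)}

theorem measurableSet_tile (n : Fin d → ℤ) : MeasurableSet (tile d L n) := by
  have : tile d L n =
      ⋂ i : Fin d, (fun x : Space d => x i) ⁻¹' Set.Ico (L * n i) (L * n i + L) := by
    ext x; simp [tile]
  rw [this]
  exact MeasurableSet.iInter fun i => measurableSet_Ico.preimage (by fun_prop)

theorem mem_tile_iff (hL : 0 < L) {n : Fin d → ℤ} {x : Space d} :
    x ∈ tile d L n ↔ (fun i => ⌊x i / L⌋) = n := by
  rw [funext_iff]
  refine forall_congr' fun i => ?_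
  rw [Int.floor_eq_iff, le_div_iff₀ hL, div_lt_iff₀ hL, Set.mem_Ico]
  constructor <;> rintro ⟨h1, h2⟩ <;> constructor <;> linarith

theorem add_latticeVec_mem_tile {n : Fin d → ℤ} {x : Space d} :
    x + latticeVec L n ∈ tile d L n ↔ x ∈ tile d L 0 := by
  refine forall_congr' fun i => ?_
  simp only [PiLp.add_apply, latticeVec_apply, Set.mem_Ico, Pi.zero_apply, Int.cast_zero, mul_zero,
    zero_add]
  constructor <;> rintro ⟨h1, h2⟩ <;> constructor <;> linarith

theorem tile_zero_ae_eq_cube : tile d L 0 =ᵐ[volume] cube d L := by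
  have h1 : tile d L 0 = WithLp.ofLp ⁻¹' (Set.pi Set.univ fun _ : Fin d => Set.Ico 0 L) := by
    ext x; simp [tile]
  have h2 : cube d L = WithLp.ofLp ⁻¹' (Set.pi Set.univ fun _ : Fin d => Set.Ioo 0 L) := by
    ext x; simp [cube]
  rw [h1, h2]
  exact (PiLp.volume_preserving_ofLp (Fin d)).quasiMeasurePreserving.preimage_ae_eq
    ((Measure.univ_pi_Ico_ae_eq_Icc (f := fun _ => (0 : ℝ)) (g := fun _ => L)).trans
      (Measure.univ_pi_Ioo_ae_eq_Icc (f := fun _ => (0 : ℝ)) (g := fun _ => L)).symm)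

theorem restrict_tile_zero : volume.restrict (tile d L 0) = volume.restrict (cube d L) :=
  Measure.restrict_congr_set tile_zero_ae_eq_cube

theorem iUnion_tile (hL : 0 < L) : ⋃ n, tile d L n = Set.univ := by
  refine Set.eq_univ_of_forall fun x => Set.mem_iUnion.mpr ⟨_, (mem_tile_iff hL).mpr rfl⟩

theorem pairwise_disjoint_tile (hL : 0 < L) : Pairwise (Function.onFun Disjoint (tile d L)) := by
  intro m n hmn
  refine Set.disjoint_left.mpr fun x hm hn => hmn ?_
  rw [← (mem_tile_iff hL).mp hm, ← (mem_tile_iff hL).mp hn]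

theorem measurePreserving_restrict_tile (n : Fin d → ℤ) :
    MeasurePreserving (fun x => x + latticeVec L n) (volume.restrict (cube d L))
      (volume.restrict (tile d L n)) := by
  have h := (measurePreserving_add_right (volume : Measure (Space d))
    (latticeVec L n)).restrict_preimage (measurableSet_tile (L := L) n)
  have h' : (fun x : Space d => x + latticeVec L n) ⁻¹' tile d L n = tile d L 0 := by
    ext x; exact add_latticeVec_mem_tile
  rwa [h', restrict_tile_zero] at h

theorem measurableEmbedding_add_latticeVec (n : Fin d → ℤ) :
    MeasurableEmbedding fun x : Space d => x + latticeVec L n :=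
  measurableEmbedding_addRight _

theorem AEPeriodic.ae_eq_of_ae_eq_cube {E : Type*} (hL : 0 < L) {f g : Space d → E}
    (hf : AEPeriodic L f) (hg : AEPeriodic L g) (h : f =ᵐ[volume.restrict (cube d L)] g) :
    f =ᵐ[volume] g := by
  rw [EventuallyEq, ← Measure.restrict_univ (μ := volume), ← iUnion_tile (d := d) hL,
    ae_restrict_iUnion_iff]
  intro n
  have hmp := measurePreserving_restrict_tile (L := L) n
  rw [← hmp.map_eq, (measurableEmbedding_add_latticeVec n).ae_map_iff]
  filter_upwards [h, ae_restrict_of_ae (hf n), ae_restrict_of_ae (hg n)] with x h1 h2 h3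
  rw [h2, h3, h1]

variable {E : Type*} [NormedAddCommGroup E]

/-- Every point has a neighbourhood covered by finitely many tiles, and `f` is integrable on each
tile by translation. -/
theorem AEPeriodic.locallyIntegrable (hL : 0 < L) {f : Space d → E} (hf : AEPeriodic L f)
    (hfi : IntegrableOn f (cube d L)) : LocallyIntegrable f := by
  have htile : ∀ n, IntegrableOn f (tile d L n) := by
    intro n
    have hmp := measurePreserving_restrict_tile (L := L) n
    rw [IntegrableOn, ← hmp.integrable_comp_emb (measurableEmbedding_add_latticeVec n)]
    exact (integrable_congr (ae_restrict_of_ae (hf n))).mpr hfi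
  intro x
  let T : Finset (Fin d → ℤ) :=
    Fintype.piFinset fun i => Finset.Icc ⌊(x i - L) / L⌋ ⌊(x i + L) / L⌋
  refine ⟨⋃ n ∈ T, tile d L n, ?_, (integrableOn_finset_iUnion).mpr fun n _ => htile n⟩
  have hU : {y : Space d | ∀ i, y i ∈ Set.Ioo (x i - L) (x i + L)} ∈ 𝓝 x := by
    have : {y : Space d | ∀ i, y i ∈ Set.Ioo (x i - L) (x i + L)} =
        ⋂ i, (fun y : Space d => y i) ⁻¹' Set.Ioo (x i - L) (x i + L) := by ext; simp
    rw [this]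
    refine (isOpen_iInter_of_finite fun i => isOpen_Ioo.preimage (by fun_prop)).mem_nhds ?_
    simp [hL]
  refine mem_of_superset hU fun y hy => ?_
  refine Set.mem_biUnion (x := fun i => ⌊y i / L⌋) ?_ ((mem_tile_iff hL).mpr rfl)
  simp only [T, Finset.mem_coe, Fintype.mem_piFinset, Finset.mem_Icc]
  intro i
  have := hy i
  constructor <;> refine Int.floor_le_floor (div_le_div_of_nonneg_right ?_ hL.le)
  · exact this.1.le
  · exact this.2.le

variable [NormedSpace ℝ E]

/-- Unfolding: the integral over space is cut into tiles and each tile is moved back to the cube,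
where the translates of `ψ` add up to its periodization. The set `T` makes that sum finite. -/
theorem integral_smul_eq_setIntegral_cube (hL : 0 < L) {f : Space d → E} (hf : AEPeriodic L f)
    (hfi : IntegrableOn f (cube d L)) {ψ : Space d → ℝ} (hψ : Continuous ψ)
    (hψc : HasCompactSupport ψ) (T : Finset (Fin d → ℤ))
    (hT : ∀ x ∈ cube d L, ∀ n ∉ T, ψ (x + latticeVec L n) = 0) :
    ∫ x, ψ x • f x = ∫ x in cube d L, (∑ n ∈ T, ψ (x + latticeVec L n)) • f x := by
  have hint : Integrable fun x => ψ x • f x :=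
    (hf.locallyIntegrable hL hfi).integrable_smul_left_of_hasCompactSupport hψ hψc
  have hsum := hasSum_integral_iUnion (f := fun x => ψ x • f x) (μ := volume)
    (measurableSet_tile (d := d) (L := L)) (pairwise_disjoint_tile hL) hint.integrableOn
  have hterm : ∀ n, ∫ x in tile d L n, ψ x • f x =
      ∫ x in cube d L, ψ (x + latticeVec L n) • f x := by
    intro n
    rw [← (measurePreserving_restrict_tile (L := L) n).integral_comp
      (measurableEmbedding_add_latticeVec n)]
    refine integral_congr_ae ?_
    filter_upwards [ae_restrict_of_ae (hf n)] with x hx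
    rw [hx]
  have hsum' := hasSum_sum_of_ne_finset_zero (f := fun n => ∫ x in tile d L n, ψ x • f x)
    (s := T) (L := .unconditional _) (fun n hn => by
      rw [hterm]
      refine setIntegral_eq_zero_of_forall_eq_zero fun x hx => ?_
      rw [hT x hx n hn, zero_smul])
  rw [iUnion_tile hL, setIntegral_univ] at hsum
  rw [hsum.unique hsum']
  simp_rw [hterm, Finset.sum_smul]
  rw [integral_finsetSum]
  intro n _
  have := ((measurePreserving_restrict_tile (L := L) n).integrable_comp_emb
    (measurableEmbedding_add_latticeVec n)).mpr (hint.integrableOn (s := tile d L n))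
  refine this.congr ?_
  filter_upwards [ae_restrict_of_ae (hf n)] with x hx
  simp only [Function.comp, hx]

theorem exists_finset_notMem_of_isCompact (hL : 0 < L) {K : Set (Space d)} (hK : IsCompact K) :
    ∃ T : Finset (Fin d → ℤ), ∀ x ∈ cube d L, ∀ n ∉ T, x + latticeVec L n ∉ K := by
  obtain ⟨R, hR⟩ := hK.isBounded.exists_norm_le
  refine ⟨Fintype.piFinset fun _ => Finset.Icc (-⌈(R + L) / L⌉) ⌈(R + L) / L⌉, ?_⟩
  intro x hx n hn hmem
  refine hn ?_
  simp only [Fintype.mem_piFinset, Finset.mem_Icc]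
  intro i
  have h1 : |x i + L * n i| ≤ R := (PiLp.norm_apply_le (x + latticeVec L n) i).trans (hR _ hmem)
  have h2 := hx i
  -- The shifted coordinate is at most `R` in size and `x i` is less than `L`, so `L * n i` is at
  -- most `R + L` in size.
  have h3 : |(n i : ℝ)| ≤ (R + L) / L := by
    have h5 : |L * n i| ≤ R + L := by
      rw [abs_le] at h1 ⊢
      constructor <;> linarith [h2.1, h2.2, h1.1, h1.2]
    rwa [abs_mul, abs_of_pos hL, mul_comm, ← le_div_iff₀ hL] at h5
  have h4 := h3.trans (Int.le_ceil _)
  rw [abs_le] at h4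
  exact ⟨by exact_mod_cast h4.1, by exact_mod_cast h4.2⟩

end Lattice

/-! ### A smooth partition of unity adapted to the lattice. -/

section PartitionOfUnity

/-- A smooth function on `ℝ^d` supported in `[-L, L]^d` whose translates by the period lattice form
a partition of unity. -/
noncomputable def cutoff (d : ℕ) (L : ℝ) (x : Space d) : ℝ :=
  ∏ i, (Real.smoothTransition (x i / L + 1) - Real.smoothTransition (x i / L))

theorem contDiff_cutoff : ContDiff ℝ ∞ (cutoff d L) := by
  unfold cutoff
  refine contDiff_prod fun i _ => ContDiff.sub ?_ ?_
  · exact Real.smoothTransition.contDiff.comp (by fun_prop)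
  · exact Real.smoothTransition.contDiff.comp (by fun_prop)

theorem cutoff_eq_zero (hL : 0 < L) {x : Space d} {i : Fin d} (h : L < |x i|) :
    cutoff d L x = 0 := by
  refine Finset.prod_eq_zero (Finset.mem_univ i) ?_
  rcases lt_abs.mp h with h | h
  · have : 1 < x i / L := by rwa [lt_div_iff₀ hL, one_mul]
    rw [Real.smoothTransition.one_of_one_le (by linarith),
      Real.smoothTransition.one_of_one_le this.le, sub_self]
  · have : x i / L < -1 := by rw [div_lt_iff₀ hL]; linarith
    rw [Real.smoothTransition.zero_of_nonpos (by linarith),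
      Real.smoothTransition.zero_of_nonpos (by linarith), sub_self]

theorem cutoff_eventuallyEq_zero (hL : 0 < L) {x : Space d} {i : Fin d} (h : L < |x i|) :
    cutoff d L =ᶠ[𝓝 x] fun _ => 0 := by
  have ho : IsOpen {y : Space d | L < |y i|} := isOpen_lt continuous_const (by fun_prop)
  filter_upwards [ho.mem_nhds h] with y hy
  exact cutoff_eq_zero hL hy

theorem hasCompactSupport_cutoff (hL : 0 < L) : HasCompactSupport (cutoff d L) := by
  have hK : IsCompact (WithLp.toLp 2 '' Set.pi Set.univ fun _ : Fin d => Set.Icc (-L) L) :=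
    (isCompact_univ_pi fun _ => isCompact_Icc).image (PiLp.continuous_toLp 2 _)
  refine HasCompactSupport.intro hK fun x hx => ?_
  by_contra h
  refine hx ⟨x.ofLp, fun i _ => ?_, rfl⟩
  by_contra hi
  refine h (cutoff_eq_zero hL (i := i) ?_)
  rwa [Set.mem_Icc, ← abs_le, not_le] at hi

/-- The lattice points whose translates of the cube meet the support of the cutoff. -/
def cutoffIndices (d : ℕ) : Finset (Fin d → ℤ) := Fintype.piFinset fun _ => {-1, 0}

theorem lt_abs_add_latticeVec (hL : 0 < L) {x : Space d} (hx : x ∈ cube d L) {n : Fin d → ℤ}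
    (hn : n ∉ cutoffIndices d) : ∃ i, L < |(x + latticeVec L n) i| := by
  simp only [cutoffIndices, Fintype.mem_piFinset, Finset.mem_insert, Finset.mem_singleton,
    not_forall, not_or] at hn
  obtain ⟨i, h1, h2⟩ := hn
  refine ⟨i, ?_⟩
  have h3 := hx i
  rw [PiLp.add_apply, latticeVec_apply, lt_abs]
  rcases lt_or_ge 0 (n i) with h | h
  · left
    have : (1 : ℝ) ≤ n i := by exact_mod_cast h
    nlinarith [h3.1]
  · right
    have : (n i : ℝ) ≤ -2 := by
      have : n i ≤ -2 := by omega
      exact_mod_cast this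
    nlinarith [h3.2]

/-- The sum over the product index set factors over the coordinates. With `s = x i / L ∈ (0, 1)` and
`T` the smooth transition, each factor telescopes to `T (s + 1) - T (s - 1) = 1 - 0`. -/
theorem sum_cutoff (hL : 0 < L) {x : Space d} (hx : x ∈ cube d L) :
    ∑ n ∈ cutoffIndices d, cutoff d L (x + latticeVec L n) = 1 := by
  have h : ∀ i, ∑ m ∈ ({-1, 0} : Finset ℤ), (Real.smoothTransition ((x i + L * m) / L + 1) -
      Real.smoothTransition ((x i + L * m) / L)) = 1 := by
    intro i
    have hx' := hx i
    have h1 : 0 < x i / L := div_pos hx'.1 hL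
    have h2 : x i / L < 1 := by rw [div_lt_one hL]; exact hx'.2
    have e1 : (x i + L * ((-1 : ℤ) : ℝ)) / L = x i / L - 1 := by
      field_simp; push_cast; ring
    rw [Finset.sum_pair (by norm_num), e1, Int.cast_zero, mul_zero, add_zero,
      Real.smoothTransition.one_of_one_le (by linarith : 1 ≤ x i / L + 1),
      Real.smoothTransition.zero_of_nonpos (by linarith : x i / L - 1 ≤ 0)]
    ring_nf
  calc ∑ n ∈ cutoffIndices d, cutoff d L (x + latticeVec L n)
      = ∏ i : Fin d, ∑ m ∈ ({-1, 0} : Finset ℤ),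
        (Real.smoothTransition ((x i + L * m) / L + 1) -
          Real.smoothTransition ((x i + L * m) / L)) := by
        rw [Finset.prod_univ_sum]; rfl
    _ = 1 := by simp only [h, Finset.prod_const_one]

/-- The translates sum to the constant one on the open cube, so their derivatives cancel. -/
theorem sum_fderiv_cutoff (hL : 0 < L) {x : Space d} (hx : x ∈ cube d L) (v : Space d) :
    ∑ n ∈ cutoffIndices d, fderiv ℝ (cutoff d L) (x + latticeVec L n) v = 0 := by
  have hd : ∀ n : Fin d → ℤ, DifferentiableAt ℝ (fun y => cutoff d L (y + latticeVec L n)) x := by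
    intro n
    exact ((contDiff_cutoff.differentiable (by simp)).comp
      (differentiable_id.add_const _)).differentiableAt
  have h1 : fderiv ℝ (fun y => ∑ n ∈ cutoffIndices d, cutoff d L (y + latticeVec L n)) x = 0 := by
    have : (fun y => ∑ n ∈ cutoffIndices d, cutoff d L (y + latticeVec L n)) =ᶠ[𝓝 x]
        fun _ => 1 := by
      filter_upwards [isOpen_cube.mem_nhds hx] with y hy
      exact sum_cutoff hL hy
    rw [this.fderiv_eq, fderiv_const_apply]
  rw [fderiv_fun_sum fun n _ => hd n] at h1
  have h2 := congrArg (fun A : Space d →L[ℝ] ℝ => A v) h1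
  simpa [fderiv_comp_add_right] using h2

variable {E : Type*} [NormedAddCommGroup E] [NormedSpace ℝ E]

theorem integral_cutoff_smul (hL : 0 < L) {f : Space d → E} (hf : AEPeriodic L f)
    (hfi : IntegrableOn f (cube d L)) : ∫ x, cutoff d L x • f x = ∫ x in cube d L, f x := by
  rw [integral_smul_eq_setIntegral_cube hL hf hfi contDiff_cutoff.continuous
    (hasCompactSupport_cutoff hL) (cutoffIndices d)]
  · refine setIntegral_congr_fun measurableSet_cube fun x hx => ?_
    simp only [sum_cutoff hL hx, one_smul]
  · intro x hx n hn
    obtain ⟨i, hi⟩ := lt_abs_add_latticeVec hL hx hn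
    exact cutoff_eq_zero hL hi

theorem integral_fderiv_cutoff_smul (hL : 0 < L) {f : Space d → E} (hf : AEPeriodic L f)
    (hfi : IntegrableOn f (cube d L)) (v : Space d) :
    ∫ x, fderiv ℝ (cutoff d L) x v • f x = 0 := by
  rw [integral_smul_eq_setIntegral_cube hL hf hfi
    ((contDiff_cutoff.continuous_fderiv (by simp)).clm_apply continuous_const)
    ((hasCompactSupport_cutoff hL).fderiv_apply ℝ v) (cutoffIndices d)]
  · refine setIntegral_eq_zero_of_forall_eq_zero fun x hx => ?_
    simp only [sum_fderiv_cutoff hL hx, zero_smul]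
  · intro x hx n hn
    obtain ⟨i, hi⟩ := lt_abs_add_latticeVec hL hx hn
    rw [(cutoff_eventuallyEq_zero hL hi).fderiv_eq, fderiv_const_apply]
    rfl

end PartitionOfUnity

/-! ### Weak derivatives tested against periodic functions. -/

section PeriodicTestFunctions

theorem isBounded_cube : Bornology.IsBounded (cube d L) := by
  have hK : IsCompact (WithLp.toLp 2 '' Set.pi Set.univ fun _ : Fin d => Set.Icc 0 L) :=
    (isCompact_univ_pi fun _ => isCompact_Icc).image (PiLp.continuous_toLp 2 _)
  refine hK.isBounded.subset fun x hx => ⟨x.ofLp, fun i _ => ?_, rfl⟩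
  exact Set.Ioo_subset_Icc_self (hx i)

theorem integrableOn_cube_mul {f χ : Space d → ℝ} (hf : LocallyIntegrable f)
    (hχ : Continuous χ) : IntegrableOn (fun x => f x * χ x) (cube d L) :=
  ((hf.integrableOn_isCompact isBounded_cube.isCompact_closure).mul_continuousOn
    hχ.continuousOn isBounded_cube.isCompact_closure).mono_set subset_closure

theorem IsPeriodic.fderiv {χ : Space d → ℝ} (hχ : IsPeriodic L χ) (v : Space d) :
    IsPeriodic L fun x => fderiv ℝ χ x v := by
  intro x i
  have : (fun y => χ (y + EuclideanSpace.single i L)) = χ := funext fun y => hχ y i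
  have h2 := fderiv_comp_add_right (𝕜 := ℝ) (f := χ) (x := x) (EuclideanSpace.single i L)
  rw [this] at h2
  simp only [h2]

/-- `f'` is the weak partial derivative of `f` on `ℝ^d` in the direction `v`. -/
def IsWeakDeriv (v : Space d) (f f' : Space d → ℝ) : Prop :=
  ∀ ψ : Space d → ℝ, IsTestFunction Set.univ ψ →
    ∫ x, f x * fderiv ℝ ψ x v = -∫ x, f' x * ψ x

/-- A periodic `χ` has no compact support, so the test function is `cutoff * χ`. Unfolding replaces
the cutoff by one and its derivative by zero, which leaves the identity on the cube. -/
theorem IsWeakDeriv.setIntegral_cube (hL : 0 < L) {v : Space d} {f f' : Space d → ℝ}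
    (h : IsWeakDeriv v f f') (hf : AEPeriodic L f) (hf' : AEPeriodic L f')
    (hfi : IntegrableOn f (cube d L)) (hfi' : IntegrableOn f' (cube d L)) {χ : Space d → ℝ}
    (hχ : ContDiff ℝ ∞ χ) (hχp : IsPeriodic L χ) :
    ∫ x in cube d L, f x * fderiv ℝ χ x v = -∫ x in cube d L, f' x * χ x := by
  have hfl := hf.locallyIntegrable hL hfi
  have hfl' := hf'.locallyIntegrable hL hfi'
  have hdc : Continuous fun x => fderiv ℝ χ x v :=
    (hχ.continuous_fderiv (by simp)).clm_apply continuous_const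
  have hec : Continuous fun x => fderiv ℝ (cutoff d L) x v :=
    (contDiff_cutoff.continuous_fderiv (by simp)).clm_apply continuous_const
  have htest : IsTestFunction Set.univ fun x => cutoff d L x * χ x :=
    ⟨contDiff_cutoff.mul hχ, (hasCompactSupport_cutoff hL).mul_right, Set.subset_univ _⟩
  have key := h _ htest
  have h1 : ∀ x, f x * fderiv ℝ (fun x => cutoff d L x * χ x) x v =
      cutoff d L x • (f x * fderiv ℝ χ x v) + fderiv ℝ (cutoff d L) x v • (f x * χ x) := by
    intro x
    rw [fderiv_fun_mul ((contDiff_cutoff.differentiable (by simp)) x)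
      ((hχ.differentiable (by simp)) x)]
    simp only [add_apply, smul_apply, smul_eq_mul]
    ring
  have h2 : ∀ x, f' x * (cutoff d L x * χ x) = cutoff d L x • (f' x * χ x) := by
    intro x; rw [smul_eq_mul]; ring
  simp only [h1, h2] at key
  have p1 : AEPeriodic L fun x => f x * fderiv ℝ χ x v :=
    hf.comp₂ (hχp.fderiv v).aePeriodic (· * ·)
  have p2 : AEPeriodic L fun x => f x * χ x := hf.comp₂ hχp.aePeriodic (· * ·)
  have p3 : AEPeriodic L fun x => f' x * χ x := hf'.comp₂ hχp.aePeriodic (· * ·)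
  have i1 : IntegrableOn (fun x => f x * fderiv ℝ χ x v) (cube d L) :=
    integrableOn_cube_mul hfl hdc
  have i2 : IntegrableOn (fun x => f x * χ x) (cube d L) :=
    integrableOn_cube_mul hfl hχ.continuous
  have i3 : IntegrableOn (fun x => f' x * χ x) (cube d L) :=
    integrableOn_cube_mul hfl' hχ.continuous
  rw [integral_add, integral_cutoff_smul hL p1 i1, integral_fderiv_cutoff_smul hL p2 i2,
    integral_cutoff_smul hL p3 i3, add_zero] at key
  · exact key
  · exact (p1.locallyIntegrable hL i1).integrable_smul_left_of_hasCompactSupport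
      contDiff_cutoff.continuous (hasCompactSupport_cutoff hL)
  · exact (p2.locallyIntegrable hL i2).integrable_smul_left_of_hasCompactSupport
      hec ((hasCompactSupport_cutoff hL).fderiv_apply ℝ v)

end PeriodicTestFunctions

/-! ### Weak derivatives as Fourier multipliers. -/

section Derivatives

/-- The standard basis vector of `ℝ^d`. -/
noncomputable abbrev stdVec (j : Fin d) : Space d := EuclideanSpace.single j 1

/-- The phase `2π k·x / L` of a character. -/
noncomputable def phase (L : ℝ) (k : Fin d → ℤ) (x : Space d) : ℝ :=
  2 * Real.pi / L * ∑ j, (k j : ℝ) * x j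

/-- The Fourier multiplier `2πi k_j / L` of the partial derivative `∂_j`. -/
noncomputable def derivSymbol (L : ℝ) (j : Fin d) (k : Fin d → ℤ) : ℂ :=
  Complex.I * (2 * Real.pi / L * k j : ℝ)

theorem conj_derivSymbol (j : Fin d) (k : Fin d → ℤ) :
    (starRingEnd ℂ) (derivSymbol L j k) = -derivSymbol L j k := by
  rw [derivSymbol, map_mul, Complex.conj_I, Complex.conj_ofReal, neg_mul]

theorem derivSymbol_neg (j : Fin d) (k : Fin d → ℤ) :
    derivSymbol L j (-k) = -derivSymbol L j k := by
  simp [derivSymbol]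

theorem character_eq (k : Fin d → ℤ) (x : Space d) :
    character L k x = Real.cos (phase L k x) + Complex.I * Real.sin (phase L k x) := by
  rw [character, mul_comm Complex.I, Complex.exp_mul_I, ← Complex.ofReal_cos,
    ← Complex.ofReal_sin, mul_comm Complex.I, phase]

theorem phase_add_single (hL : 0 < L) (k : Fin d → ℤ) (x : Space d) (i : Fin d) :
    phase L k (x + EuclideanSpace.single i L) = phase L k x + k i * (2 * Real.pi) := by
  simp only [phase, PiLp.add_apply, PiLp.single_apply, mul_add, Finset.sum_add_distrib,
    mul_ite, mul_zero, Finset.sum_ite_eq', Finset.mem_univ, if_true]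
  field_simp

theorem isPeriodic_cos_phase (hL : 0 < L) (k : Fin d → ℤ) :
    IsPeriodic L fun x : Space d => Real.cos (phase L k x) := by
  intro x i
  simp only [phase_add_single hL, Real.cos_add_int_mul_two_pi]

theorem isPeriodic_sin_phase (hL : 0 < L) (k : Fin d → ℤ) :
    IsPeriodic L fun x : Space d => Real.sin (phase L k x) := by
  intro x i
  simp only [phase_add_single hL, Real.sin_add_int_mul_two_pi]

theorem isPeriodic_character (hL : 0 < L) (k : Fin d → ℤ) :
    IsPeriodic L (character (d := d) L k) := by
  intro x i
  simp only [character_eq, phase_add_single hL, Real.cos_add_int_mul_two_pi,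
    Real.sin_add_int_mul_two_pi]

theorem contDiff_phase (k : Fin d → ℤ) : ContDiff ℝ ∞ (phase (d := d) L k) := by
  unfold phase; fun_prop

theorem hasFDerivAt_phase (k : Fin d → ℤ) (x : Space d) :
    HasFDerivAt (phase L k)
      ((2 * Real.pi / L) • ∑ j, (k j : ℝ) • (EuclideanSpace.proj j : Space d →L[ℝ] ℝ)) x := by
  have : phase L k = ((2 * Real.pi / L) • ∑ j, (k j : ℝ) •
      (EuclideanSpace.proj j : Space d →L[ℝ] ℝ) : Space d →L[ℝ] ℝ) := by
    ext y; simp [phase]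
  rw [this]
  exact ContinuousLinearMap.hasFDerivAt _

theorem fderiv_phase_stdVec (k : Fin d → ℤ) (x : Space d) (j : Fin d) :
    fderiv ℝ (phase L k) x (stdVec j) = 2 * Real.pi / L * k j := by
  rw [(hasFDerivAt_phase k x).fderiv]
  simp [stdVec]

theorem fderiv_cos_phase (k : Fin d → ℤ) (x : Space d) (j : Fin d) :
    fderiv ℝ (fun y => Real.cos (phase L k y)) x (stdVec j) =
      -(2 * Real.pi / L * k j) * Real.sin (phase L k x) := by
  rw [fderiv_cos (hasFDerivAt_phase k x).differentiableAt, smul_apply,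
    fderiv_phase_stdVec, smul_eq_mul]
  ring

theorem fderiv_sin_phase (k : Fin d → ℤ) (x : Space d) (j : Fin d) :
    fderiv ℝ (fun y => Real.sin (phase L k y)) x (stdVec j) =
      (2 * Real.pi / L * k j) * Real.cos (phase L k x) := by
  rw [fderiv_sin (hasFDerivAt_phase k x).differentiableAt, smul_apply,
    fderiv_phase_stdVec, smul_eq_mul]
  ring

theorem contDiff_character (k : Fin d → ℤ) : ContDiff ℝ ∞ (character (d := d) L k) := by
  exact Complex.contDiff_exp.comp (contDiff_const.mul
    (Complex.ofRealCLM.contDiff.comp (contDiff_phase k)))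

theorem fderiv_character (k : Fin d → ℤ) (x : Space d) (j : Fin d) :
    fderiv ℝ (character L k) x (stdVec j) = derivSymbol L j k * character L k x := by
  have h1 : HasFDerivAt (fun y : Space d => Complex.I * ((phase L k y : ℝ) : ℂ))
      (Complex.I • Complex.ofRealCLM.comp (fderiv ℝ (phase L k) x)) x :=
    (Complex.ofRealCLM.hasFDerivAt.comp x
      (hasFDerivAt_phase k x).differentiableAt.hasFDerivAt).const_mul Complex.I
  have h2 := h1.cexp
  have h3 : fderiv ℝ (character L k) x = _ := h2.fderiv
  rw [h3]
  simp only [smul_apply, ContinuousLinearMap.comp_apply, fderiv_phase_stdVec, smul_eq_mul,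
    Complex.ofRealCLM_apply]
  rw [derivSymbol, mul_comm]
  rfl

theorem fourierCoef_eq {f : Space d → ℝ} (hf : IntegrableOn f (cube d L))
    (k : Fin d → ℤ) :
    fourierCoef L f k = (∫ x in cube d L, f x * Real.cos (phase L k x) : ℝ) -
      Complex.I * (∫ x in cube d L, f x * Real.sin (phase L k x) : ℝ) := by
  have hc : IntegrableOn (fun x => f x * Real.cos (phase L k x)) (cube d L) := by
    refine Integrable.mul_bdd (c := 1) hf ?_ (Eventually.of_forall fun x => Real.abs_cos_le_one _)
    exact (Real.continuous_cos.comp (contDiff_phase k).continuous).aestronglyMeasurable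
  have hs : IntegrableOn (fun x => f x * Real.sin (phase L k x)) (cube d L) := by
    refine Integrable.mul_bdd (c := 1) hf ?_ (Eventually.of_forall fun x => Real.abs_sin_le_one _)
    exact (Real.continuous_sin.comp (contDiff_phase k).continuous).aestronglyMeasurable
  rw [← integral_complex_ofReal, ← integral_complex_ofReal, ← integral_const_mul,
    ← integral_sub hc.ofReal (hs.ofReal.const_mul _), fourierCoef]
  refine integral_congr_ae (Eventually.of_forall fun x => ?_)
  beta_reduce
  rw [character_neg, character_eq, map_add, map_mul, Complex.conj_ofReal, Complex.conj_ofReal,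
    Complex.conj_I]
  push_cast
  ring

/-- Test the weak derivative with the real and imaginary parts of the character, which are smooth
and periodic. -/
theorem IsWeakDeriv.fourierCoef (hL : 0 < L) {j : Fin d} {f f' : Space d → ℝ}
    (h : IsWeakDeriv (stdVec j) f f') (hf : AEPeriodic L f) (hf' : AEPeriodic L f')
    (hfi : IntegrableOn f (cube d L)) (hfi' : IntegrableOn f' (cube d L)) (k : Fin d → ℤ) :
    fourierCoef L f' k = derivSymbol L j k * fourierCoef L f k := by
  have hc := h.setIntegral_cube hL hf hf' hfi hfi'
    (Real.contDiff_cos.comp (contDiff_phase k)) (isPeriodic_cos_phase hL k)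
  have hs := h.setIntegral_cube hL hf hf' hfi hfi'
    (Real.contDiff_sin.comp (contDiff_phase k)) (isPeriodic_sin_phase hL k)
  have e1 : ∀ x, f x * fderiv ℝ (Real.cos ∘ phase L k) x (stdVec j) =
      -(2 * Real.pi / L * k j) * (f x * Real.sin (phase L k x)) := by
    intro x
    have := fderiv_cos_phase (L := L) k x j
    rw [Function.comp_def, this]; ring
  have e2 : ∀ x, f x * fderiv ℝ (Real.sin ∘ phase L k) x (stdVec j) =
      (2 * Real.pi / L * k j) * (f x * Real.cos (phase L k x)) := by
    intro x
    have := fderiv_sin_phase (L := L) k x j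
    rw [Function.comp_def, this]; ring
  simp only [e1, e2, integral_const_mul, Function.comp] at hc hs
  rw [fourierCoef_eq hfi', fourierCoef_eq hfi, derivSymbol]
  rw [← neg_eq_iff_eq_neg] at hc hs
  rw [← hc, ← hs]
  push_cast
  linear_combination ((2 * Real.pi / L * k j : ℂ) *
    (∫ x in cube d L, f x * Real.sin (phase L k x) : ℝ)) * Complex.I_sq

/-- Integration by parts over the cube, for functions related by the Fourier multiplier of a
partial derivative. -/
theorem setIntegral_mul_eq_neg_of_fourierCoef (hL : 0 < L) {j : Fin d} {f f' h h' : Space d → ℝ}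
    (hf : MemLp f 2 (volume.restrict (cube d L))) (hf' : MemLp f' 2 (volume.restrict (cube d L)))
    (hh : MemLp h 2 (volume.restrict (cube d L))) (hh' : MemLp h' 2 (volume.restrict (cube d L)))
    (hff' : ∀ k, fourierCoef L f' k = derivSymbol L j k * fourierCoef L f k)
    (hhh' : ∀ k, fourierCoef L h' k = derivSymbol L j k * fourierCoef L h k) :
    ∫ x in cube d L, f x * h' x = -∫ x in cube d L, f' x * h x := by
  have s1 := hasSum_fourierCoef_mul hL hf hh'
  have s2 := (hasSum_fourierCoef_mul hL hf' hh).neg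
  have e : (fun k => (starRingEnd ℂ) (fourierCoef L f k) * fourierCoef L h' k) =
      fun k => -((starRingEnd ℂ) (fourierCoef L f' k) * fourierCoef L h k) := by
    ext k
    rw [hff', hhh', map_mul, conj_derivSymbol]
    ring
  rw [e] at s1
  have := s1.unique s2
  rw [← Complex.ofReal_neg, Complex.ofReal_inj] at this
  have hLd := (pow_pos hL d).ne'
  have h3 : L ^ d * ((∫ x in cube d L, f x * h' x) + ∫ x in cube d L, f' x * h x) = 0 := by
    linarith
  linarith [(mul_eq_zero.mp h3).resolve_left hLd]

theorem memLp_sum_translates {ψ : Space d → ℝ} (hψ : Continuous ψ) (hψc : HasCompactSupport ψ)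
    (T : Finset (Fin d → ℤ)) :
    MemLp (fun x => ∑ n ∈ T, ψ (x + latticeVec L n)) 2 (volume.restrict (cube d L)) := by
  refine memLp_finsetSum _ fun n _ => ?_
  exact ((hψ.memLp_of_hasCompactSupport (μ := volume) hψc).comp_measurePreserving
    (measurePreserving_add_right volume (latticeVec L n))).restrict _

/-- Unfolding read backwards: the Fourier coefficients of a periodization are values of the Fourier
transform on the dual lattice. -/
theorem fourierCoef_sum_translates (hL : 0 < L) {ψ : Space d → ℝ} (hψ : Continuous ψ)
    (hψc : HasCompactSupport ψ) {T : Finset (Fin d → ℤ)}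
    (hT : ∀ x ∈ cube d L, ∀ n ∉ T, ψ (x + latticeVec L n) = 0) (k : Fin d → ℤ) :
    fourierCoef L (fun x => ∑ n ∈ T, ψ (x + latticeVec L n)) k =
      ∫ x, ψ x • character L (-k) x := by
  rw [integral_smul_eq_setIntegral_cube hL (isPeriodic_character hL (-k)).aePeriodic _ hψ hψc T hT,
    fourierCoef]
  · refine integral_congr_ae (Eventually.of_forall fun x => ?_)
    simp only [Complex.real_smul, mul_comm]
  · exact ((continuous_character (-k)).continuousOn.integrableOn_compact
      isBounded_cube.isCompact_closure).mono_set subset_closure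

theorem integral_fderiv_smul_character {ψ : Space d → ℝ} (hψ : ContDiff ℝ ∞ ψ)
    (hψc : HasCompactSupport ψ) (j : Fin d) (k : Fin d → ℤ) :
    ∫ x, fderiv ℝ ψ x (stdVec j) • character L (-k) x =
      derivSymbol L j k * ∫ x, ψ x • character L (-k) x := by
  have hdc : Continuous fun x => fderiv ℝ ψ x (stdVec j) :=
    (hψ.continuous_fderiv (by simp)).clm_apply continuous_const
  have hcc : Continuous fun x => fderiv ℝ (character L (-k)) x (stdVec j) :=
    ((contDiff_character (-k)).continuous_fderiv (by simp)).clm_apply continuous_const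
  have h := integral_smul_fderiv_eq_neg_fderiv_smul_of_integrable (μ := volume) (f := ψ)
    (g := character L (-k)) (v := stdVec j)
    ((hdc.smul (continuous_character (-k))).integrable_of_hasCompactSupport
      (hψc.fderiv_apply ℝ (stdVec j)).smul_right)
    ((hψ.continuous.smul hcc).integrable_of_hasCompactSupport hψc.smul_right)
    ((hψ.continuous.smul (continuous_character (-k))).integrable_of_hasCompactSupport
      hψc.smul_right)
    (fun x _ => hψ.differentiable (by simp) x)
    (fun x _ => (contDiff_character (-k)).differentiable (by simp) x)
  rw [← neg_eq_iff_eq_neg] at h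
  rw [← h, ← integral_neg, ← integral_const_mul]
  refine integral_congr_ae (Eventually.of_forall fun x => ?_)
  simp only [fderiv_character, derivSymbol_neg, Complex.real_smul]
  ring

/-- Converse of `IsWeakDeriv.fourierCoef`. Both integrals are unfolded onto the cube; the
periodizations of `ψ` and of its derivative are related by the same multiplier, so Parseval gives
the integration by parts. -/
theorem isWeakDeriv_of_fourierCoef (hL : 0 < L) {j : Fin d} {f f' : Space d → ℝ}
    (hf : AEPeriodic L f) (hf' : AEPeriodic L f')
    (hf2 : MemLp f 2 (volume.restrict (cube d L))) (hf2' : MemLp f' 2 (volume.restrict (cube d L)))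
    (h : ∀ k, fourierCoef L f' k = derivSymbol L j k * fourierCoef L f k) :
    IsWeakDeriv (stdVec j) f f' := by
  rintro ψ ⟨hψ, hψc, -⟩
  have : IsFiniteMeasure (volume.restrict (cube d L)) :=
    ⟨by simpa using isBounded_cube.measure_lt_top⟩
  have hdc : Continuous fun x => fderiv ℝ ψ x (stdVec j) :=
    (hψ.continuous_fderiv (by simp)).clm_apply continuous_const
  have hds := hψc.fderiv_apply ℝ (stdVec j)
  obtain ⟨T, hT⟩ := exists_finset_notMem_of_isCompact (d := d) hL hψc
  have hT1 : ∀ x ∈ cube d L, ∀ n ∉ T, ψ (x + latticeVec L n) = 0 :=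
    fun x hx n hn => image_eq_zero_of_notMem_tsupport (hT x hx n hn)
  have hT2 : ∀ x ∈ cube d L, ∀ n ∉ T, fderiv ℝ ψ (x + latticeVec L n) (stdVec j) = 0 := by
    intro x hx n hn
    rw [fderiv_of_notMem_tsupport ℝ (hT x hx n hn)]
    rfl
  have h1 := integral_smul_eq_setIntegral_cube hL hf (hf2.integrable (by norm_num)) hdc hds T hT2
  have h2 := integral_smul_eq_setIntegral_cube hL hf' (hf2'.integrable (by norm_num))
    hψ.continuous hψc T hT1
  simp only [smul_eq_mul, mul_comm _ (f _), mul_comm _ (f' _)] at h1 h2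
  rw [h1, h2]
  refine setIntegral_mul_eq_neg_of_fourierCoef hL hf2 hf2'
    (memLp_sum_translates hψ.continuous hψc T)
    (memLp_sum_translates hdc hds T) h fun k => ?_
  rw [fourierCoef_sum_translates hL hψ.continuous hψc hT1,
    fourierCoef_sum_translates hL hdc hds hT2, integral_fderiv_smul_character hψ hψc]

end Derivatives

/-! ### Gradient and divergence on the Fourier side, Green's identity and Poincaré's inequality. -/

section FourierGradDiv

instance isFiniteMeasure_cube : IsFiniteMeasure (volume.restrict (cube d L)) :=
  ⟨by simpa using isBounded_cube.measure_lt_top⟩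

theorem MemLp.integrableOn_cube {E : Type*} [NormedAddCommGroup E] {f : Space d → E}
    (hf : MemLp f 2 (volume.restrict (cube d L))) : IntegrableOn f (cube d L) :=
  hf.integrable (by norm_num)

theorem memLp_coord {D : Space d → Space d} (hD : MemLp D 2 (volume.restrict (cube d L)))
    (j : Fin d) : MemLp (fun x => D x j) 2 (volume.restrict (cube d L)) :=
  (EuclideanSpace.proj j : Space d →L[ℝ] ℝ).comp_memLp' hD

theorem integrableOn_mul {f h : Space d → ℝ} (hf : MemLp f 2 (volume.restrict (cube d L)))
    (hh : MemLp h 2 (volume.restrict (cube d L))) : IntegrableOn (fun x => f x * h x) (cube d L) :=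
  MemLp.integrable_mul hf hh

theorem inner_eq_sum_mul (v w : Space d) : inner ℝ v w = ∑ j, v j * w j := by
  simp [PiLp.inner_apply, mul_comm]

/-- `g` is the gradient of `u` in terms of Fourier coefficients. -/
def HasFourierGrad (L : ℝ) (u : Space d → ℝ) (g : Space d → Space d) : Prop :=
  ∀ j k, fourierCoef L (fun x => g x j) k = derivSymbol L j k * fourierCoef L u k

/-- `r` is the divergence of `D` in terms of Fourier coefficients. -/
def HasFourierDiv (L : ℝ) (D : Space d → Space d) (r : Space d → ℝ) : Prop :=
  ∀ k, ∑ j, derivSymbol L j k * fourierCoef L (fun x => D x j) k = fourierCoef L r k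

/-- Parseval applied to each coordinate: conjugating the imaginary symbol produces the minus sign,
and summing over `j` reassembles the divergence symbol on `D`. -/
theorem HasFourierGrad.setIntegral_inner (hL : 0 < L) {u r : Space d → ℝ}
    {g D : Space d → Space d} (hug : HasFourierGrad L u g) (hDr : HasFourierDiv L D r)
    (hu : MemLp u 2 (volume.restrict (cube d L))) (hg : MemLp g 2 (volume.restrict (cube d L)))
    (hD : MemLp D 2 (volume.restrict (cube d L))) (hr : MemLp r 2 (volume.restrict (cube d L))) :
    ∫ x in cube d L, inner ℝ (g x) (D x) = -∫ x in cube d L, u x * r x := by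
  have s1 := (hasSum_fourierCoef_mul hL hu hr).neg
  have s2 := hasSum_sum (s := Finset.univ) fun j _ =>
    hasSum_fourierCoef_mul hL (memLp_coord hg j) (memLp_coord hD j)
  have e : (fun k => ∑ j, (starRingEnd ℂ) (fourierCoef L (fun x => g x j) k) *
      fourierCoef L (fun x => D x j) k) =
      fun k => -((starRingEnd ℂ) (fourierCoef L u k) * fourierCoef L r k) := by
    ext k
    rw [← hDr k, Finset.mul_sum, ← Finset.sum_neg_distrib]
    refine Finset.sum_congr rfl fun j _ => ?_
    rw [hug j k, map_mul, conj_derivSymbol]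
    ring
  rw [e] at s2
  have h := s2.unique s1
  rw [← Complex.ofReal_sum, ← Complex.ofReal_neg, Complex.ofReal_inj, ← Finset.mul_sum,
    ← mul_neg] at h
  rw [← mul_left_cancel₀ (pow_pos hL d).ne' h, ← integral_finsetSum]
  · simp only [inner_eq_sum_mul]
  · exact fun j _ => integrableOn_mul (memLp_coord hg j) (memLp_coord hD j)

theorem hasSum_sq_fourierCoef (hL : 0 < L) {f : Space d → ℝ}
    (hf : MemLp f 2 (volume.restrict (cube d L))) :
    HasSum (fun k => ‖fourierCoef L f k‖ ^ 2) (L ^ d * ∫ x in cube d L, f x ^ 2) := by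
  have h := hasSum_fourierCoef_mul hL hf hf
  have e : (fun k => (starRingEnd ℂ) (fourierCoef L f k) * fourierCoef L f k) =
      fun k => ((‖fourierCoef L f k‖ ^ 2 : ℝ) : ℂ) := by
    ext k
    rw [mul_comm, Complex.mul_conj, Complex.normSq_eq_norm_sq]
  rw [e, Complex.hasSum_ofReal] at h
  simpa only [sq] using h

theorem norm_derivSymbol_sq (j : Fin d) (k : Fin d → ℤ) :
    ‖derivSymbol L j k‖ ^ 2 = (2 * Real.pi / L) ^ 2 * (k j : ℝ) ^ 2 := by
  rw [derivSymbol, norm_mul, Complex.norm_I, one_mul, Complex.norm_real, Real.norm_eq_abs, sq_abs,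
    mul_pow]

/-- Poincaré's inequality for periodic functions with zero average. -/
theorem HasFourierGrad.poincare (hL : 0 < L) {u : Space d → ℝ} {g : Space d → Space d}
    (hug : HasFourierGrad L u g) (hu0 : fourierCoef L u 0 = 0)
    (hu : MemLp u 2 (volume.restrict (cube d L))) (hg : MemLp g 2 (volume.restrict (cube d L))) :
    (2 * Real.pi / L) ^ 2 * ∫ x in cube d L, u x ^ 2 ≤ ∫ x in cube d L, ‖g x‖ ^ 2 := by
  have s1 := (hasSum_sq_fourierCoef hL hu).mul_left ((2 * Real.pi / L) ^ 2)
  have s2 := hasSum_sum (s := Finset.univ) fun j _ => hasSum_sq_fourierCoef hL (memLp_coord hg j)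
  have h := hasSum_le (fun k => ?_) s1 s2
  · rw [← Finset.mul_sum, ← integral_finsetSum] at h
    · simp only [EuclideanSpace.norm_sq_eq, Real.norm_eq_abs, sq_abs]
      refine le_of_mul_le_mul_left ?_ (pow_pos hL d)
      linarith
    · exact fun j _ => (memLp_coord hg j).integrable_sq
  · simp only [hug _ k, norm_mul, mul_pow, norm_derivSymbol_sq, mul_assoc]
    rw [← Finset.mul_sum, ← Finset.sum_mul]
    -- The zero mode vanishes by `hu0`; otherwise some `k i` is a nonzero integer, so the sum of the
    -- squares is at least one.
    by_cases hk : k = 0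
    · simp [hk, hu0]
    · gcongr
      refine le_mul_of_one_le_left (by positivity) ?_
      obtain ⟨i, hi⟩ := Function.ne_iff.mp hk
      have h1 : (1 : ℝ) ≤ (k i : ℝ) ^ 2 := by
        have hi' : k i ≠ 0 := hi
        have : (1 : ℤ) ≤ (k i) ^ 2 := Int.add_one_le_iff.mpr (sq_pos_iff.mpr hi')
        exact_mod_cast this
      exact h1.trans (Finset.single_le_sum (f := fun j => (k j : ℝ) ^ 2)
        (fun j _ => sq_nonneg _) (Finset.mem_univ i))

theorem fourierCoef_zero_eq (u : Space d → ℝ) :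
    fourierCoef L u 0 = ((∫ x in cube d L, u x : ℝ) : ℂ) := by
  rw [← integral_complex_ofReal, fourierCoef]
  simp [character]

theorem volume_cube_ne_zero (hL : 0 < L) : volume (cube d L) ≠ 0 := by
  refine (isOpen_cube.measure_pos volume ⟨WithLp.toLp 2 fun _ => L / 2, fun i => ?_⟩).ne'
  exact ⟨by simpa using hL, by simpa using hL⟩

theorem setAverage_eq_zero_iff (hL : 0 < L) {u : Space d → ℝ} :
    ⨍ x in cube d L, u x = 0 ↔ fourierCoef L u 0 = 0 := by
  rw [fourierCoef_zero_eq, setAverage_eq, smul_eq_zero, inv_eq_zero, measureReal_eq_zero_iff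
    isBounded_cube.measure_lt_top.ne, Complex.ofReal_eq_zero]
  simp [volume_cube_ne_zero hL]

theorem fourierCoef_congr {f h : Space d → ℝ} (hfh : f =ᵐ[volume.restrict (cube d L)] h)
    (k : Fin d → ℤ) : fourierCoef L f k = fourierCoef L h k := by
  refine integral_congr_ae ?_
  filter_upwards [hfh] with x hx
  rw [hx]

theorem integrableOn_character_mul {f : Space d → ℝ} (hf : IntegrableOn f (cube d L))
    (k : Fin d → ℤ) : IntegrableOn (fun x => character L k x * (f x : ℂ)) (cube d L) :=
  Integrable.bdd_mul (c := 1) hf.ofReal (continuous_character k).aestronglyMeasurable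
    (Eventually.of_forall fun x => (norm_character k x).le)

theorem fourierCoef_add {f h : Space d → ℝ} (hf : IntegrableOn f (cube d L))
    (hh : IntegrableOn h (cube d L)) (k : Fin d → ℤ) :
    fourierCoef L (fun x => f x + h x) k = fourierCoef L f k + fourierCoef L h k := by
  simp only [fourierCoef, Complex.ofReal_add, mul_add]
  exact integral_add (integrableOn_character_mul hf _) (integrableOn_character_mul hh _)

theorem fourierCoef_const_mul (c : ℝ) (f : Space d → ℝ) (k : Fin d → ℤ) :
    fourierCoef L (fun x => c * f x) k = c * fourierCoef L f k := by
  simp only [fourierCoef]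
  rw [← integral_const_mul]
  refine integral_congr_ae (Eventually.of_forall fun x => ?_)
  push_cast
  ring

theorem fourierCoef_sum {ι : Type*} (s : Finset ι) {f : ι → Space d → ℝ}
    (hf : ∀ i ∈ s, IntegrableOn (f i) (cube d L)) (k : Fin d → ℤ) :
    fourierCoef L (fun x => ∑ i ∈ s, f i x) k = ∑ i ∈ s, fourierCoef L (f i) k := by
  simp only [fourierCoef, Complex.ofReal_sum, Finset.mul_sum]
  exact integral_finsetSum _ fun i hi => integrableOn_character_mul (hf i hi) _

/-- On a space of finite measure `L²` convergence implies `L¹` convergence, and characters have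
modulus one. -/
theorem tendsto_fourierCoef {ι : Type*} {l : Filter ι} {F : ι → Space d → ℝ} {f : Space d → ℝ}
    (hF : ∀ n, MemLp (F n) 2 (volume.restrict (cube d L)))
    (hf : MemLp f 2 (volume.restrict (cube d L)))
    (h : Tendsto (fun n => eLpNorm (fun x => F n x - f x) 2 (volume.restrict (cube d L))) l (𝓝 0))
    (k : Fin d → ℤ) : Tendsto (fun n => fourierCoef L (F n) k) l (𝓝 (fourierCoef L f k)) := by
  refine tendsto_integral_of_L1' _
    (integrableOn_character_mul (MemLp.integrableOn_cube hf) _).aestronglyMeasurable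
    (Eventually.of_forall fun n => integrableOn_character_mul (MemLp.integrableOn_cube (hF n)) _) ?_
  set C := volume.restrict (cube d L) Set.univ ^ (1 / (1 : ENNReal).toReal -
    1 / (2 : ENNReal).toReal) with hC
  have hle : ∀ n, eLpNorm ((fun x => character L (-k) x * (F n x : ℂ)) -
      fun x => character L (-k) x * (f x : ℂ)) 1 (volume.restrict (cube d L)) ≤
      eLpNorm (fun x => F n x - f x) 2 (volume.restrict (cube d L)) * C := by
    intro n
    refine le_trans ?_ (eLpNorm_le_eLpNorm_mul_rpow_measure_univ (by norm_num)
      ((hF n).sub hf).aestronglyMeasurable)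
    refine eLpNorm_mono fun x => ?_
    rw [Pi.sub_apply, ← mul_sub, norm_mul, norm_character, one_mul,
      ← Complex.ofReal_sub, Complex.norm_real]
  have hCtop : C ≠ ⊤ := by
    rw [hC]
    refine ENNReal.rpow_ne_top_of_nonneg (by norm_num) (measure_ne_top _ _)
  refine tendsto_of_tendsto_of_tendsto_of_le_of_le tendsto_const_nhds ?_ (fun _ => zero_le) hle
  simpa using ENNReal.Tendsto.mul_const h (Or.inr hCtop)

end FourierGradDiv

/-! ### The Fourier description of the periodic Sobolev space. -/

section WeakGradient

theorem gradient_apply_eq_fderiv (ψ : Space d → ℝ) (x : Space d) (i : Fin d) :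
    gradient ψ x i = fderiv ℝ ψ x (stdVec i) := by
  have h : inner ℝ (gradient ψ x) (stdVec i) = fderiv ℝ ψ x (stdVec i) := by
    simp [gradient]
  rw [← h, inner_eq_sum_mul]
  simp [stdVec]

theorem isWeakGradient_iff {u : Space d → ℝ} {g : Space d → Space d} :
    IsWeakGradient u g ↔ LocallyIntegrable u ∧ LocallyIntegrable g ∧
      ∀ j, IsWeakDeriv (stdVec j) u fun x => g x j := by
  simp only [IsWeakGradient, gradient_apply_eq_fderiv, IsWeakDeriv]
  exact and_congr_right fun _ => and_congr_right fun _ =>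
    ⟨fun h j ψ hψ => h ψ hψ j, fun h ψ hψ j => h j ψ hψ⟩

theorem LocallyIntegrable.coord {g : Space d → Space d} (hg : LocallyIntegrable g) (j : Fin d) :
    LocallyIntegrable fun x => g x j := by
  intro x
  obtain ⟨s, hs, h⟩ := hg x
  exact ⟨s, hs, (EuclideanSpace.proj j : Space d →L[ℝ] ℝ).integrable_comp h⟩

/-- This makes the choice inside `weakGrad` harmless: any weak gradient computes it almost
everywhere. -/
theorem IsWeakGradient.ae_eq {u : Space d → ℝ} {g g' : Space d → Space d}
    (h : IsWeakGradient u g) (h' : IsWeakGradient u g') : g =ᵐ[volume] g' := by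
  have hj : ∀ j, ∀ᵐ x, g x j = g' x j := by
    intro j
    refine ae_eq_of_integral_contDiff_smul_eq (LocallyIntegrable.coord h.2.1 j)
      (LocallyIntegrable.coord h'.2.1 j) fun ψ hψ hψc => ?_
    have h1 := h.2.2 ψ ⟨hψ, hψc, Set.subset_univ _⟩ j
    have h2 := h'.2.2 ψ ⟨hψ, hψc, Set.subset_univ _⟩ j
    rw [h1, neg_inj] at h2
    simpa only [smul_eq_mul, mul_comm] using h2
  filter_upwards [ae_all_iff.mpr hj] with x hx
  ext j
  exact hx j

theorem isWeakGradient_weakGrad {u : Space d → ℝ} {g : Space d → Space d}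
    (h : IsWeakGradient u g) : IsWeakGradient u (weakGrad u) := by
  have hex : ∃ g, IsWeakGradient u g := ⟨g, h⟩
  rw [weakGrad, dif_pos hex]
  exact hex.choose_spec

theorem LocallyIntegrable.comp_add_right {E : Type*} [NormedAddCommGroup E] {f : Space d → E}
    (hf : LocallyIntegrable f) (v : Space d) : LocallyIntegrable fun x => f (x + v) := by
  have := (locallyIntegrable_map_homeomorph (Homeomorph.addRight v) (f := f)
    (μ := (volume : Measure (Space d)))).mp (by
      rw [Homeomorph.coe_addRight, map_add_right_eq_self]; exact hf)
  exact this

theorem IsWeakGradient.comp_add_right {u : Space d → ℝ} {g : Space d → Space d}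
    (h : IsWeakGradient u g) (v : Space d) :
    IsWeakGradient (fun x => u (x + v)) fun x => g (x + v) := by
  rw [isWeakGradient_iff] at h ⊢
  refine ⟨LocallyIntegrable.comp_add_right h.1 v, LocallyIntegrable.comp_add_right h.2.1 v,
    fun j ψ hψ => ?_⟩
  have hψ' : IsTestFunction Set.univ fun x => ψ (x - v) :=
    ⟨hψ.1.comp (contDiff_id.sub contDiff_const),
      hψ.2.1.comp_homeomorph (Homeomorph.subRight v), Set.subset_univ _⟩
  have key := h.2.2 j _ hψ'
  rw [← integral_add_right_eq_self _ v,
    ← integral_add_right_eq_self (fun x => g x j * ψ (x - v)) v] at key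
  simpa only [fderiv_comp_sub, add_sub_cancel_right] using key

/-- The translate of `g` is a weak gradient of the translate of `u`, which is `u` itself; uniqueness
concludes, but only almost everywhere. -/
theorem IsWeakGradient.aePeriodic {u : Space d → ℝ} {g : Space d → Space d}
    (h : IsWeakGradient u g) (hu : IsPeriodic L u) : AEPeriodic L g := by
  intro n
  have h' := h.comp_add_right (latticeVec L n)
  simp only [hu.add_latticeVec] at h'
  exact h'.ae_eq h

/-- Reduction of the coordinates modulo `L`. -/
noncomputable def wrap (L : ℝ) (x : Space d) : Space d :=
  WithLp.toLp 2 fun i => L * Int.fract (x i / L)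

theorem wrap_of_mem_cube (hL : 0 < L) {x : Space d} (hx : x ∈ cube d L) : wrap L x = x := by
  ext i
  have h := hx i
  have h1 : Int.fract (x i / L) = x i / L := by
    rw [Int.fract_eq_self, div_nonneg_iff, div_lt_one hL]
    exact ⟨Or.inl ⟨h.1.le, hL.le⟩, h.2⟩
  simp only [wrap, h1]
  field_simp

/-- An `L²` class on the cube carries no periodicity. Composition with `wrap` gives a representative
that is periodic at every point, as `H1Per` demands. -/
theorem isPeriodic_comp_wrap (hL : 0 < L) {β : Type} (f : Space d → β) :
    IsPeriodic L fun x => f (wrap L x) := by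
  intro x i
  have : wrap L (x + EuclideanSpace.single i L) = wrap L x := by
    ext j
    simp only [wrap, PiLp.add_apply, PiLp.single_apply, add_div]
    split_ifs
    · rw [div_self hL.ne', Int.fract_add_one]
    · simp
  simp only [this]

theorem comp_wrap_ae_eq (hL : 0 < L) {β : Type} (f : Space d → β) :
    (fun x => f (wrap L x)) =ᵐ[volume.restrict (cube d L)] f := by
  filter_upwards [ae_restrict_mem measurableSet_cube] with x hx
  rw [wrap_of_mem_cube hL hx]

theorem HasFourierGrad.isWeakGradient (hL : 0 < L) {u : Space d → ℝ} {g : Space d → Space d}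
    (hug : HasFourierGrad L u g) (hup : AEPeriodic L u) (hgp : AEPeriodic L g)
    (hu : MemLp u 2 (volume.restrict (cube d L))) (hg : MemLp g 2 (volume.restrict (cube d L))) :
    IsWeakGradient u g := by
  rw [isWeakGradient_iff]
  refine ⟨hup.locallyIntegrable hL (MemLp.integrableOn_cube hu),
    hgp.locallyIntegrable hL (MemLp.integrableOn_cube hg), fun j => ?_⟩
  exact isWeakDeriv_of_fourierCoef hL hup (hgp.comp fun v => v j) hu (memLp_coord hg j) (hug j)

theorem H1PerZero_props (hL : 0 < L) {u : Space d → ℝ} (hu : u ∈ H1PerZero d L) :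
    MemLp u 2 (volume.restrict (cube d L)) ∧ MemLp (weakGrad u) 2 (volume.restrict (cube d L)) ∧
      HasFourierGrad L u (weakGrad u) ∧ fourierCoef L u 0 = 0 := by
  obtain ⟨⟨⟨hup, hu2⟩, g, hg, hg2⟩, hu0⟩ := hu
  have hw := isWeakGradient_weakGrad hg
  have hw2 : MemLp (weakGrad u) 2 (volume.restrict (cube d L)) :=
    hg2.ae_eq (ae_restrict_of_ae (hg.ae_eq hw))
  refine ⟨hu2, hw2, fun j k => ?_, (setAverage_eq_zero_iff hL).mp hu0⟩
  exact ((isWeakGradient_iff.mp hw).2.2 j).fourierCoef hL hup.aePeriodic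
    ((hw.aePeriodic hup).comp fun v => v j) (MemLp.integrableOn_cube hu2)
    (MemLp.integrableOn_cube (memLp_coord hw2 j)) k

/-- Only the values of `g` in the cube enter the hypotheses, so its periodic extension serves as the
weak gradient on the whole space. -/
theorem HasFourierGrad.mem_H1PerZero (hL : 0 < L) {u : Space d → ℝ} {g : Space d → Space d}
    (hug : HasFourierGrad L u g) (hup : IsPeriodic L u)
    (hu : MemLp u 2 (volume.restrict (cube d L))) (hg : MemLp g 2 (volume.restrict (cube d L)))
    (hu0 : fourierCoef L u 0 = 0) :
    u ∈ H1PerZero d L ∧ weakGrad u =ᵐ[volume.restrict (cube d L)] g := by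
  have hgw := comp_wrap_ae_eq hL g
  have hg' : MemLp (fun x => g (wrap L x)) 2 (volume.restrict (cube d L)) := hg.ae_eq hgw.symm
  have hug' : HasFourierGrad L u fun x => g (wrap L x) := by
    intro j k
    rw [← hug j k]
    refine fourierCoef_congr ?_ k
    filter_upwards [hgw] with x hx
    rw [hx]
  have hw := hug'.isWeakGradient hL hup.aePeriodic (isPeriodic_comp_wrap hL g).aePeriodic hu hg'
  exact ⟨⟨⟨⟨hup, hu⟩, _, hw, hg'⟩, (setAverage_eq_zero_iff hL).mpr hu0⟩,
    ((isWeakGradient_weakGrad hw).ae_eq hw).restrict.trans hgw⟩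

end WeakGradient

/-! ### The Fourier description of the Gauss-law sets. -/

section Divergence

/-- The support lies inside the cube, so integrals over the cube are integrals over the whole space
and integration by parts has no boundary term. -/
theorem IsTestFunction.hasFourierGrad {ψ : Space d → ℝ} (hψ : IsTestFunction (cube d L) ψ) :
    HasFourierGrad L ψ (gradient ψ) := by
  obtain ⟨hs, hc, hsupp⟩ := hψ
  intro j k
  have h1 : fourierCoef L ψ k = ∫ x, ψ x • character L (-k) x := by
    rw [fourierCoef, setIntegral_eq_integral_of_forall_compl_eq_zero]
    · simp only [Complex.real_smul, mul_comm]
    · intro x hx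
      rw [image_eq_zero_of_notMem_tsupport fun h => hx (hsupp h), Complex.ofReal_zero, mul_zero]
  have h2 : fourierCoef L (fun x => gradient ψ x j) k =
      ∫ x, fderiv ℝ ψ x (stdVec j) • character L (-k) x := by
    rw [fourierCoef, setIntegral_eq_integral_of_forall_compl_eq_zero]
    · simp only [Complex.real_smul, mul_comm, gradient_apply_eq_fderiv]
    · intro x hx
      rw [gradient_apply_eq_fderiv, fderiv_of_notMem_tsupport ℝ fun h => hx (hsupp h), zero_apply,
        Complex.ofReal_zero, mul_zero]
  rw [h1, h2, integral_fderiv_smul_character hs hc]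

theorem continuous_gradient {ψ : Space d → ℝ} (hψ : ContDiff ℝ ∞ ψ) : Continuous (gradient ψ) :=
  (InnerProductSpace.toDual ℝ (Space d)).symm.continuous.comp (hψ.continuous_fderiv (by simp))

theorem memLp_of_continuous {E : Type*} [NormedAddCommGroup E] [SecondCountableTopology E]
    {f : Space d → E} (hf : Continuous f) : MemLp f 2 (volume.restrict (cube d L)) := by
  obtain ⟨C, hC⟩ := isBounded_cube.isCompact_closure.exists_bound_of_continuousOn
    (f := f) (s := closure (cube d L)) hf.continuousOn
  refine MemLp.of_bound hf.aestronglyMeasurable C ?_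
  filter_upwards [ae_restrict_mem measurableSet_cube] with x hx
  exact hC x (subset_closure hx)

theorem HasFourierDiv.isWeakDivOn (hL : 0 < L) {D : Space d → Space d} {r : Space d → ℝ}
    (h : HasFourierDiv L D r) (hD : MemLp D 2 (volume.restrict (cube d L)))
    (hr : MemLp r 2 (volume.restrict (cube d L))) : IsWeakDivOn (cube d L) D r := by
  refine ⟨(MemLp.integrableOn_cube hD).locallyIntegrableOn,
    (MemLp.integrableOn_cube hr).locallyIntegrableOn, fun ψ hψ => ?_⟩
  simp only [real_inner_comm (gradient ψ _), mul_comm (r _)]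
  exact hψ.hasFourierGrad.setIntegral_inner hL h (memLp_of_continuous hψ.1.continuous)
    (memLp_of_continuous (continuous_gradient hψ.1)) hD hr

theorem IsWeakDivOn.ae_eq {D : Space d → Space d} {r s : Space d → ℝ}
    (hr : IsWeakDivOn (cube d L) D r) (hs : IsWeakDivOn (cube d L) D s) :
    r =ᵐ[volume.restrict (cube d L)] s := by
  have h := isOpen_cube.ae_eq_zero_of_integral_contDiff_smul_eq_zero
    (f := fun x => r x - s x) (hr.2.1.sub hs.2.1) fun ψ hψ hψc hψs => ?_
  · rw [EventuallyEq, ae_restrict_iff' measurableSet_cube]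
    filter_upwards [h] with x hx hx'
    exact sub_eq_zero.mp (hx hx')
  · have key := (hr.2.2 ψ ⟨hψ, hψc, hψs⟩).symm.trans (hs.2.2 ψ ⟨hψ, hψc, hψs⟩)
    rw [neg_inj] at key
    have hint : ∀ q : Space d → ℝ, LocallyIntegrableOn q (cube d L) →
        IntegrableOn (fun x => q x * ψ x) (cube d L) := by
      intro q hq
      have h1 : IntegrableOn (fun x => q x * ψ x) (tsupport ψ) :=
        (hq.integrableOn_compact_subset hψs hψc).mul_continuousOn hψ.continuous.continuousOn hψc
      have h2 : Function.support (fun x => q x * ψ x) ⊆ tsupport ψ :=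
        (Function.support_mul_subset_right q ψ).trans (subset_tsupport ψ)
      exact ((integrableOn_iff_integrable_of_support_subset h2).mp h1).integrableOn
    rw [← setIntegral_eq_integral_of_forall_compl_eq_zero (s := cube d L)]
    · simp only [smul_eq_mul, mul_comm (ψ _), sub_mul]
      rw [integral_sub (hint r hr.2.1) (hint s hs.2.1), key, sub_self]
    · intro x hx
      rw [image_eq_zero_of_notMem_tsupport fun h => hx (hψs h), zero_smul]

theorem fderiv_coord {V : Space d → Space d} {x : Space d} (hV : DifferentiableAt ℝ V x)
    (v : Space d) (j : Fin d) : fderiv ℝ (fun y => V y j) x v = fderiv ℝ V x v j := by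
  have h := (EuclideanSpace.proj j : Space d →L[ℝ] ℝ).hasFDerivAt.comp x hV.hasFDerivAt
  have h' : fderiv ℝ (fun y => V y j) x = _ := h.fderiv
  rw [h']
  rfl

theorem isWeakDeriv_of_contDiff {f : Space d → ℝ} (hf : ContDiff ℝ 1 f) (v : Space d) :
    IsWeakDeriv v f fun x => fderiv ℝ f x v := by
  rintro ψ ⟨hψ, hψc, -⟩
  have hdf : Continuous fun x => fderiv ℝ f x v :=
    (hf.continuous_fderiv (by simp)).clm_apply continuous_const
  have hdψ : Continuous fun x => fderiv ℝ ψ x v :=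
    (hψ.continuous_fderiv (by simp)).clm_apply continuous_const
  exact integral_mul_fderiv_eq_neg_fderiv_mul_of_integrable
    ((hdf.mul hψ.continuous).integrable_of_hasCompactSupport hψc.mul_left)
    ((hf.continuous.mul hdψ).integrable_of_hasCompactSupport (hψc.fderiv_apply ℝ v).mul_left)
    ((hf.continuous.mul hψ.continuous).integrable_of_hasCompactSupport hψc.mul_left)
    (fun x _ => hf.differentiable (by simp) x) (fun x _ => hψ.differentiable (by simp) x)

theorem fourierCoef_fderiv (hL : 0 < L) {f : Space d → ℝ} (hf : ContDiff ℝ 1 f)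
    (hfp : IsPeriodic L f) (j : Fin d) (k : Fin d → ℤ) :
    fourierCoef L (fun x => fderiv ℝ f x (stdVec j)) k = derivSymbol L j k * fourierCoef L f k :=
  (isWeakDeriv_of_contDiff hf (stdVec j)).fourierCoef hL hfp.aePeriodic (hfp.fderiv _).aePeriodic
    (MemLp.integrableOn_cube (memLp_of_continuous hf.continuous))
    (MemLp.integrableOn_cube (memLp_of_continuous
      ((hf.continuous_fderiv (by simp)).clm_apply continuous_const))) k

theorem hasFourierDiv_classicalDiv (hL : 0 < L) {V : Space d → Space d} (hV : ContDiff ℝ 1 V)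
    (hVp : IsPeriodic L V) : HasFourierDiv L V (classicalDiv V) := by
  intro k
  have hVj : ∀ j, ContDiff ℝ 1 fun x => V x j := fun j =>
    (EuclideanSpace.proj j : Space d →L[ℝ] ℝ).contDiff.comp hV
  have hd : ∀ x j, fderiv ℝ (fun y => V y j) x (stdVec j) = fderiv ℝ V x (stdVec j) j :=
    fun x j => fderiv_coord (hV.differentiable (by simp) x) _ j
  have h1 : classicalDiv V = fun x => ∑ j, fderiv ℝ (fun y => V y j) x (stdVec j) := by
    ext x
    simp only [classicalDiv, hd]
  rw [h1, fourierCoef_sum]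
  · refine Finset.sum_congr rfl fun j _ => ?_
    rw [fourierCoef_fderiv hL (hVj j) fun x i => by rw [hVp x i]]
  · intro j _
    exact MemLp.integrableOn_cube (memLp_of_continuous
      (((hVj j).continuous_fderiv (by simp)).clm_apply continuous_const))

theorem continuous_classicalDiv {V : Space d → Space d} (hV : ContDiff ℝ 1 V) :
    Continuous (classicalDiv V) := by
  unfold classicalDiv
  refine continuous_finsetSum _ fun j _ => ?_
  exact (EuclideanSpace.proj j : Space d →L[ℝ] ℝ).continuous.comp
    ((hV.continuous_fderiv (by simp)).clm_apply continuous_const)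

/-- The relation holds for periodic `C¹` fields and passes to the limit, because each coefficient is
continuous in `L²`. The divergence `g` of the approximation agrees with `r` by uniqueness of weak
divergences. -/
theorem hasFourierDiv_of_mem_gaussSet (hL : 0 < L) {D : Space d → Space d} {r : Space d → ℝ}
    (h : D ∈ gaussSet d L r) : HasFourierDiv L D r := by
  obtain ⟨⟨hD, g, hg, hDg, V, hV, hlim⟩, hDr⟩ := h
  intro k
  rw [← fourierCoef_congr (hDg.ae_eq hDr) k]
  have hV2 : ∀ n, MemLp (V n) 2 (volume.restrict (cube d L)) :=
    fun n => memLp_of_continuous (hV n).1.continuous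
  have l1 : ∀ j, Tendsto (fun n => fourierCoef L (fun x => V n x j) k) atTop
      (𝓝 (fourierCoef L (fun x => D x j) k)) := by
    intro j
    refine tendsto_fourierCoef (fun n => memLp_coord (hV2 n) j) (memLp_coord hD j) ?_ k
    refine tendsto_of_tendsto_of_tendsto_of_le_of_le tendsto_const_nhds hlim
      (fun _ => zero_le) fun n => ?_
    exact (eLpNorm_mono fun x => PiLp.norm_apply_le (V n x - D x) j).trans le_self_add
  have l2 : Tendsto (fun n => fourierCoef L (classicalDiv (V n)) k) atTop
      (𝓝 (fourierCoef L g k)) := by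
    refine tendsto_fourierCoef (fun n => memLp_of_continuous (continuous_classicalDiv (hV n).1))
      hg ?_ k
    exact tendsto_of_tendsto_of_tendsto_of_le_of_le tendsto_const_nhds hlim
      (fun _ => zero_le) fun n => le_add_self
  have l3 := tendsto_finsetSum Finset.univ fun j _ => (l1 j).const_mul (derivSymbol L j k)
  refine tendsto_nhds_unique l3 (l2.congr fun n => ?_)
  exact (hasFourierDiv_classicalDiv hL (hV n).1 (hV n).2 k).symm

theorem hasFDerivAt_re_const_mul_character (c : ℂ) (k : Fin d → ℤ) (x : Space d) :
    HasFDerivAt (fun y => (c * character L k y).re)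
      (Complex.reCLM.comp (c • fderiv ℝ (character L k) x)) x :=
  Complex.reCLM.hasFDerivAt.comp x
    (((contDiff_character k).differentiable (by simp) x).hasFDerivAt.const_mul c)

theorem contDiff_fourierPartialSum (f : Space d → ℝ) (s : Finset (Fin d → ℤ)) :
    ContDiff ℝ ∞ (fourierPartialSum L f s) := by
  refine contDiff_const.mul (ContDiff.sum fun k _ => ?_)
  exact Complex.reCLM.contDiff.comp (contDiff_const.mul (contDiff_character k))

theorem fderiv_fourierPartialSum (f : Space d → ℝ) (s : Finset (Fin d → ℤ)) (x : Space d)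
    (j : Fin d) : fderiv ℝ (fourierPartialSum L f s) x (stdVec j) =
      (L ^ d)⁻¹ * ∑ k ∈ s, (derivSymbol L j k * fourierCoef L f k * character L k x).re := by
  have h := (HasFDerivAt.fun_sum fun k (_ : k ∈ s) => hasFDerivAt_re_const_mul_character (L := L)
    (fourierCoef L f k) k x).const_mul (L ^ d)⁻¹
  have h' : fderiv ℝ (fourierPartialSum L f s) x = _ := h.fderiv
  rw [h']
  simp only [smul_apply, sum_apply, ContinuousLinearMap.comp_apply, fderiv_character, smul_eq_mul,
    Complex.reCLM_apply]
  congr 1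
  refine Finset.sum_congr rfl fun k _ => ?_
  congr 1
  ring

theorem isPeriodic_fourierPartialSum (hL : 0 < L) (f : Space d → ℝ) (s : Finset (Fin d → ℤ)) :
    IsPeriodic L (fourierPartialSum L f s) := by
  intro x i
  simp only [fourierPartialSum, isPeriodic_character hL _ x i]

/-- The approximating smooth fields are Fourier partial sums. With the same frequencies in every
coordinate, the divergence of the partial sum of `D` is exactly the partial sum of `r`, so both
converge in `L²`. -/
theorem mem_gaussSet_of_hasFourierDiv (hL : 0 < L) {D : Space d → Space d} {r : Space d → ℝ}
    (h : HasFourierDiv L D r) (hD : MemLp D 2 (volume.restrict (cube d L)))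
    (hr : MemLp r 2 (volume.restrict (cube d L))) : D ∈ gaussSet d L r := by
  have hdiv := h.isWeakDivOn hL hD hr
  -- `HDivPer` asks for a sequence; there are countably many frequencies, so a sequence of finite
  -- sets exhausts them.
  obtain ⟨s, hs⟩ := exists_seq_tendsto (atTop : Filter (Finset (Fin d → ℤ)))
  let V : ℕ → Space d → Space d := fun n x =>
    WithLp.toLp 2 fun j => fourierPartialSum L (fun y => D y j) (s n) x
  have hV : ∀ n, ContDiff ℝ 1 (V n) := fun n => by
    rw [contDiff_euclidean]
    exact fun j => (contDiff_fourierPartialSum _ _).of_le (by simp)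
  have hVdiv : ∀ n, classicalDiv (V n) = fourierPartialSum L r (s n) := by
    intro n
    ext x
    have h1 : ∀ j, fderiv ℝ (V n) x (stdVec j) j = _ := fun j =>
      (fderiv_coord ((hV n).differentiable (by simp) x) (stdVec j) j).symm.trans
        (fderiv_fourierPartialSum (fun y => D y j) (s n) x j)
    simp only [classicalDiv, fourierPartialSum, h1]
    rw [← Finset.mul_sum, Finset.sum_comm]
    congr 1
    refine Finset.sum_congr rfl fun k _ => ?_
    rw [← h k, Finset.sum_mul, Complex.re_sum]
  refine ⟨⟨hD, r, hr, hdiv, V, fun n => ⟨hV n, fun x i => ?_⟩, ?_⟩, hdiv⟩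
  · simp only [V, isPeriodic_fourierPartialSum hL _ _ x i]
  · have l1 : ∀ j, Tendsto (fun n => eLpNorm (fun x => fourierPartialSum L (fun y => D y j) (s n) x
        - D x j) 2 (volume.restrict (cube d L))) atTop (𝓝 0) := fun j =>
      (tendsto_fourierPartialSum hL (memLp_coord hD j)).comp hs
    have l2 : Tendsto (fun n => eLpNorm (fun x => classicalDiv (V n) x - r x) 2
        (volume.restrict (cube d L))) atTop (𝓝 0) := by
      simp only [hVdiv]
      exact (tendsto_fourierPartialSum hL hr).comp hs
    have l3 : Tendsto (fun n => eLpNorm (fun x => V n x - D x) 2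
        (volume.restrict (cube d L))) atTop (𝓝 0) := by
      have hsum := tendsto_finsetSum Finset.univ fun j _ => l1 j
      rw [Finset.sum_const_zero] at hsum
      refine tendsto_of_tendsto_of_tendsto_of_le_of_le tendsto_const_nhds hsum
        (fun _ => zero_le) fun n => ?_
      have hle := eLpNorm_sum_le (s := (Finset.univ : Finset (Fin d)))
        (f := fun j x => ‖fourierPartialSum L (fun y => D y j) (s n) x - D x j‖)
        (μ := volume.restrict (cube d L)) (p := 2)
        (fun j _ => ((contDiff_fourierPartialSum _ _).continuous.aestronglyMeasurable.sub
          (memLp_coord hD j).aestronglyMeasurable).norm) (by norm_num)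
      simp only [eLpNorm_norm] at hle
      -- The Euclidean norm is at most the sum of the absolute values of the coordinates.
      refine le_trans (eLpNorm_mono_real fun x => ?_) hle
      rw [Finset.sum_apply]
      refine (EuclideanSpace.norm_eq _).trans_le ?_
      exact Real.sqrt_le_iff.mpr ⟨Finset.sum_nonneg fun j _ => norm_nonneg _,
        Finset.sum_sq_le_sq_sum_of_nonneg fun j _ => norm_nonneg _⟩
    simpa using l3.add l2

theorem mem_gaussSet_iff (hL : 0 < L) {D : Space d → Space d} {r : Space d → ℝ}
    (hr : MemLp r 2 (volume.restrict (cube d L))) :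
    D ∈ gaussSet d L r ↔ MemLp D 2 (volume.restrict (cube d L)) ∧ HasFourierDiv L D r :=
  ⟨fun h => ⟨h.1.1, hasFourierDiv_of_mem_gaussSet hL h⟩,
    fun h => mem_gaussSet_of_hasFourierDiv hL h.2 h.1 hr⟩

end Divergence

/-! ### Linearity of the Fourier relations. -/

section Linearity

variable {u v r s : Space d → ℝ} {g h D E : Space d → Space d}

theorem HasFourierGrad.add (hu : HasFourierGrad L u g) (hv : HasFourierGrad L v h)
    (hu2 : MemLp u 2 (volume.restrict (cube d L))) (hv2 : MemLp v 2 (volume.restrict (cube d L)))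
    (hg2 : MemLp g 2 (volume.restrict (cube d L))) (hh2 : MemLp h 2 (volume.restrict (cube d L))) :
    HasFourierGrad L (fun x => u x + v x) fun x => g x + h x := by
  intro j k
  simp only [PiLp.add_apply]
  rw [fourierCoef_add (MemLp.integrableOn_cube (memLp_coord hg2 j))
    (MemLp.integrableOn_cube (memLp_coord hh2 j)), fourierCoef_add (MemLp.integrableOn_cube hu2)
    (MemLp.integrableOn_cube hv2), hu j k, hv j k, mul_add]

theorem HasFourierGrad.const_mul (hu : HasFourierGrad L u g) (c : ℝ) :
    HasFourierGrad L (fun x => c * u x) fun x => c • g x := by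
  intro j k
  simp only [PiLp.smul_apply, smul_eq_mul]
  rw [fourierCoef_const_mul, fourierCoef_const_mul, hu j k]
  ring

theorem HasFourierGrad.congr (hu : HasFourierGrad L u g)
    (huv : u =ᵐ[volume.restrict (cube d L)] v) (hgh : g =ᵐ[volume.restrict (cube d L)] h) :
    HasFourierGrad L v h := by
  intro j k
  rw [← fourierCoef_congr huv, ← hu j k]
  refine fourierCoef_congr ?_ k
  filter_upwards [hgh] with x hx
  rw [hx]

theorem HasFourierDiv.add_const_smul (hD : HasFourierDiv L D r) (hE : HasFourierDiv L E s)
    (hD2 : MemLp D 2 (volume.restrict (cube d L))) (hE2 : MemLp E 2 (volume.restrict (cube d L)))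
    (hr2 : MemLp r 2 (volume.restrict (cube d L))) (hs2 : MemLp s 2 (volume.restrict (cube d L)))
    (c : ℝ) : HasFourierDiv L (fun x => D x + c • E x) fun x => r x + c * s x := by
  intro k
  simp only [PiLp.add_apply, PiLp.smul_apply, smul_eq_mul]
  rw [fourierCoef_add (MemLp.integrableOn_cube hr2) ((MemLp.integrableOn_cube hs2).const_mul c),
    fourierCoef_const_mul, ← hD k, ← hE k, Finset.mul_sum, ← Finset.sum_add_distrib]
  refine Finset.sum_congr rfl fun j _ => ?_
  rw [fourierCoef_add (MemLp.integrableOn_cube (memLp_coord hD2 j))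
    ((MemLp.integrableOn_cube (memLp_coord hE2 j)).const_mul c), fourierCoef_const_mul]
  ring

end Linearity

/-! ### Existence of a weak solution by Lax–Milgram. -/

section Existence

/-- The Hilbert space `L²(Ω) × L²(Ω, ℝ^d)`. -/
abbrev L2Pair (d : ℕ) (L : ℝ) : Type :=
  WithLp 2 (Lp ℝ 2 (volume.restrict (cube d L)) × Lp (Space d) 2 (volume.restrict (cube d L)))

/-- The pairs `(u, ∇u)` for periodic `u` with zero average, as a subspace of
`L²(Ω) × L²(Ω, ℝ^d)`. -/
noncomputable def gradGraph (d : ℕ) (L : ℝ) : Submodule ℝ (L2Pair d L) where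
  carrier := {p | HasFourierGrad L p.fst p.snd ∧ fourierCoef L p.fst 0 = 0}
  zero_mem' := by
    have h1 : ((0 : L2Pair d L).fst : Space d → ℝ) =ᵐ[volume.restrict (cube d L)] fun _ => 0 :=
      Lp.coeFn_zero ℝ 2 _
    have h2 : ((0 : L2Pair d L).snd : Space d → Space d) =ᵐ[volume.restrict (cube d L)]
      fun _ => 0 := Lp.coeFn_zero (Space d) 2 _
    refine ⟨HasFourierGrad.congr (fun j k => ?_) h1.symm h2.symm, ?_⟩
    · simp [fourierCoef]
    · rw [fourierCoef_congr h1]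
      simp [fourierCoef]
  add_mem' := by
    rintro p q ⟨hp, hp0⟩ ⟨hq, hq0⟩
    have h1 := Lp.coeFn_add p.fst q.fst
    have h2 := Lp.coeFn_add p.snd q.snd
    refine ⟨(hp.add hq (Lp.memLp _) (Lp.memLp _) (Lp.memLp _) (Lp.memLp _)).congr h1.symm h2.symm,
      (fourierCoef_congr h1 0).trans ?_⟩
    refine (fourierCoef_add (MemLp.integrableOn_cube (Lp.memLp p.fst))
      (MemLp.integrableOn_cube (Lp.memLp q.fst)) 0).trans ?_
    rw [hp0, hq0, add_zero]
  smul_mem' := by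
    rintro c p ⟨hp, hp0⟩
    have h1 := Lp.coeFn_smul c p.fst
    have h2 := Lp.coeFn_smul c p.snd
    refine ⟨(hp.const_mul c).congr h1.symm h2.symm, (fourierCoef_congr h1 0).trans ?_⟩
    refine (fourierCoef_const_mul c _ 0).trans ?_
    rw [hp0, mul_zero]

/-- The defining equations involve only Fourier coefficients, which are continuous in `L²`.
Closedness supplies the completeness required by Lax–Milgram. -/
theorem isClosed_gradGraph : IsClosed (gradGraph d L : Set (L2Pair d L)) := by
  refine IsSeqClosed.isClosed fun p q hp hpq => ?_
  have h1 : Tendsto (fun n => (p n).fst) atTop (𝓝 q.fst) :=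
    ((WithLp.fstL 2 ℝ _ _).continuous.tendsto q).comp hpq
  have h2 : Tendsto (fun n => (p n).snd) atTop (𝓝 q.snd) :=
    ((WithLp.sndL 2 ℝ _ _).continuous.tendsto q).comp hpq
  rw [Lp.tendsto_Lp_iff_tendsto_eLpNorm'] at h1 h2
  have l1 : ∀ k, Tendsto (fun n => fourierCoef L (p n).fst k) atTop
      (𝓝 (fourierCoef L q.fst k)) :=
    tendsto_fourierCoef (fun n => Lp.memLp _) (Lp.memLp _) h1
  have l2 : ∀ j k, Tendsto (fun n => fourierCoef L (fun x => (p n).snd x j) k) atTop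
      (𝓝 (fourierCoef L (fun x => q.snd x j) k)) := by
    intro j
    refine tendsto_fourierCoef (fun n => memLp_coord (Lp.memLp _) j) (memLp_coord (Lp.memLp _) j) ?_
    refine tendsto_of_tendsto_of_tendsto_of_le_of_le tendsto_const_nhds h2
      (fun _ => zero_le) fun n => ?_
    exact eLpNorm_mono fun x => PiLp.norm_apply_le ((p n).snd x - q.snd x) j
  refine ⟨fun j k => ?_, ?_⟩
  · refine tendsto_nhds_unique (l2 j k) (((l1 k).const_mul (derivSymbol L j k)).congr fun n => ?_)
    exact ((hp n).1 j k).symm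
  · refine tendsto_nhds_unique (l1 0) ?_
    simp only [(hp _).2, tendsto_const_nhds]

/-- Lax–Milgram for a form that sees only the gradient part `S`. The maps `F` and `S` stand for the
two components of a pair `(u, ∇u)`, `hF` for Poincaré's inequality and `M` for multiplication by
`ε`. -/
theorem exists_forall_inner_eq_of_coercive {V X Y : Type*} [NormedAddCommGroup V]
    [InnerProductSpace ℝ V] [CompleteSpace V] [NormedAddCommGroup X] [InnerProductSpace ℝ X]
    [NormedAddCommGroup Y] [InnerProductSpace ℝ Y] (F : V →L[ℝ] X) (S : V →L[ℝ] Y) (M : Y →L[ℝ] Y)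
    {a c : ℝ} (ha : 0 < a) (hc : 0 < c) (hnorm : ∀ p, ‖p‖ ^ 2 = ‖F p‖ ^ 2 + ‖S p‖ ^ 2)
    (hF : ∀ p, c * ‖F p‖ ^ 2 ≤ ‖S p‖ ^ 2) (hM : ∀ y, a * ‖y‖ ^ 2 ≤ inner ℝ (M y) y) (r : X) :
    ∃ p, ∀ q, inner ℝ (M (S p)) (S q) = inner ℝ r (F q) := by
  let B : V →L[ℝ] V →L[ℝ] ℝ := (innerSL ℝ).bilinearComp (M.comp S) S
  have hB : ∀ p q, B p q = inner ℝ (M (S p)) (S q) := fun p q => rfl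
  have hcoer : IsCoercive B := by
    refine ⟨a * (c / (1 + c)), by positivity, fun p => ?_⟩
    -- Poincaré bounds the full norm by the gradient part: `c ‖p‖² = c ‖F p‖² + c ‖S p‖² ≤ (1 + c)
    -- ‖S p‖²`.
    have h4 : c / (1 + c) * ‖p‖ ^ 2 ≤ ‖S p‖ ^ 2 := by
      rw [hnorm, div_mul_eq_mul_div, div_le_iff₀ (by positivity)]
      linarith [hF p]
    calc a * (c / (1 + c)) * ‖p‖ * ‖p‖ = a * (c / (1 + c) * ‖p‖ ^ 2) := by ring
      _ ≤ a * ‖S p‖ ^ 2 := by gcongr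
      _ ≤ B p p := hM _
  let ℓ : V →L[ℝ] ℝ := (innerSL ℝ r).comp F
  refine ⟨hcoer.continuousLinearEquivOfBilin.symm ((InnerProductSpace.toDual ℝ _).symm ℓ),
    fun q => ?_⟩
  rw [← hB, ← hcoer.continuousLinearEquivOfBilin_apply, ContinuousLinearEquiv.apply_symm_apply,
    InnerProductSpace.toDual_symm_apply]
  rfl

theorem exists_clm_smul {ε : Space d → ℝ} (hε : MemLp ε ⊤ (volume.restrict (cube d L))) :
    ∃ M : Lp (Space d) 2 (volume.restrict (cube d L)) →L[ℝ]
      Lp (Space d) 2 (volume.restrict (cube d L)),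
      ∀ a, M a =ᵐ[volume.restrict (cube d L)] fun x => ε x • a x := by
  refine ⟨(ContinuousLinearMap.lsmul ℝ ℝ).holderL (volume.restrict (cube d L)) ⊤ 2 2
    (hε.toLp ε), fun a => ?_⟩
  filter_upwards [ContinuousLinearMap.coeFn_holder (r := 2) (ContinuousLinearMap.lsmul ℝ ℝ)
    (hε.toLp ε) a, hε.coeFn_toLp] with x h1 h2
  refine h1.trans ?_
  rw [h2]
  rfl

theorem norm_sq_eq_setIntegral {E : Type*} [NormedAddCommGroup E] [InnerProductSpace ℝ E]
    (a : Lp E 2 (volume.restrict (cube d L))) : ‖a‖ ^ 2 = ∫ x in cube d L, ‖a x‖ ^ 2 := by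
  rw [← real_inner_self_eq_norm_sq, L2.inner_def]
  simp only [real_inner_self_eq_norm_sq]

theorem exists_weak_solution (hL : 0 < L) {ε ρ : Space d → ℝ} {εmin : ℝ} (hεmin : 0 < εmin)
    (hε : MemLp ε ⊤ (volume.restrict (cube d L)))
    (hεbd : ∀ᵐ x ∂volume.restrict (cube d L), εmin ≤ ε x)
    (hρ : MemLp ρ 2 (volume.restrict (cube d L))) :
    ∃ (u : Space d → ℝ) (g : Space d → Space d), MemLp u 2 (volume.restrict (cube d L)) ∧
      MemLp g 2 (volume.restrict (cube d L)) ∧ HasFourierGrad L u g ∧ fourierCoef L u 0 = 0 ∧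
      ∀ (v : Space d → ℝ) (h : Space d → Space d), MemLp v 2 (volume.restrict (cube d L)) →
        MemLp h 2 (volume.restrict (cube d L)) → HasFourierGrad L v h → fourierCoef L v 0 = 0 →
        ∫ x in cube d L, ε x * inner ℝ (g x) (h x) = ∫ x in cube d L, ρ x * v x := by
  have := isClosed_gradGraph (d := d) (L := L).completeSpace_coe
  obtain ⟨M, hM⟩ := exists_clm_smul hε
  have hMinner : ∀ a b, inner ℝ (M a) b = ∫ x in cube d L, ε x * inner ℝ (a x) (b x) := by
    intro a b
    rw [L2.inner_def]
    refine integral_congr_ae ?_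
    filter_upwards [hM a] with x hx
    rw [hx, real_inner_smul_left]
  have hMcoer : ∀ a, εmin * ‖a‖ ^ 2 ≤ inner ℝ (M a) a := by
    intro a
    rw [hMinner, norm_sq_eq_setIntegral, ← integral_const_mul]
    refine integral_mono_ae ((Lp.memLp a).norm.integrable_sq.const_mul _) ?_ ?_
    · refine (L2.integrable_inner (𝕜 := ℝ) (M a) a).congr ?_
      filter_upwards [hM a] with x hx
      rw [hx, real_inner_smul_left]
    · filter_upwards [hεbd] with x hx
      rw [real_inner_self_eq_norm_sq]
      gcongr
  obtain ⟨p, hp⟩ := exists_forall_inner_eq_of_coercive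
    ((WithLp.fstL 2 ℝ _ _).comp (gradGraph d L).subtypeL)
    ((WithLp.sndL 2 ℝ _ _).comp (gradGraph d L).subtypeL) M (c := (2 * Real.pi / L) ^ 2) hεmin
    (by positivity) (fun p => WithLp.prod_norm_sq_eq_of_L2 (p : L2Pair d L)) (fun p => by
      rw [norm_sq_eq_setIntegral, norm_sq_eq_setIntegral]
      simp only [Real.norm_eq_abs, sq_abs]
      exact HasFourierGrad.poincare hL p.2.1 p.2.2 (Lp.memLp _) (Lp.memLp _)) hMcoer (hρ.toLp ρ)
  refine ⟨(p : L2Pair d L).fst, (p : L2Pair d L).snd, Lp.memLp _, Lp.memLp _, p.2.1, p.2.2,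
    fun v h hv hh hvh hv0 => ?_⟩
  have hq : WithLp.toLp 2 (hv.toLp v, hh.toLp h) ∈ gradGraph d L :=
    ⟨hvh.congr hv.coeFn_toLp.symm hh.coeFn_toLp.symm, (fourierCoef_congr hv.coeFn_toLp 0).trans hv0⟩
  have key : inner ℝ (M (p : L2Pair d L).snd) (hh.toLp h) = inner ℝ (hρ.toLp ρ) (hv.toLp v) :=
    hp ⟨_, hq⟩
  rw [hMinner, L2.inner_def] at key
  have e1 : ∫ x in cube d L, ε x * inner ℝ ((p : L2Pair d L).snd x) (hh.toLp h x) =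
      ∫ x in cube d L, ε x * inner ℝ ((p : L2Pair d L).snd x) (h x) := by
    refine integral_congr_ae ?_
    filter_upwards [hh.coeFn_toLp] with x hx
    rw [hx]
  rw [← e1, key]
  refine integral_congr_ae ?_
  filter_upwards [hρ.coeFn_toLp, hv.coeFn_toLp] with x h1 h2
  rw [h1, h2]
  simp [mul_comm]

end Existence

/-! ### From the weak equation to the divergence of the flux. -/

section FluxDivergence

theorem contDiff_cos_phase (k : Fin d → ℤ) :
    ContDiff ℝ 1 fun x : Space d => Real.cos (phase L k x) :=
  (Real.contDiff_cos.comp (contDiff_phase k)).of_le (by simp)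

theorem contDiff_sin_phase (k : Fin d → ℤ) :
    ContDiff ℝ 1 fun x : Space d => Real.sin (phase L k x) :=
  (Real.contDiff_sin.comp (contDiff_phase k)).of_le (by simp)

/-- The wave vector `2π k / L`. -/
noncomputable def waveVec (L : ℝ) (k : Fin d → ℤ) : Space d :=
  WithLp.toLp 2 fun j => 2 * Real.pi / L * k j

theorem hasFourierGrad_cos_phase (hL : 0 < L) (k : Fin d → ℤ) :
    HasFourierGrad L (fun x => Real.cos (phase L k x))
      fun x => -Real.sin (phase L k x) • waveVec L k := by
  intro j l
  rw [← fourierCoef_fderiv hL (contDiff_cos_phase k) (isPeriodic_cos_phase hL k)]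
  simp only [fderiv_cos_phase, waveVec, PiLp.smul_apply, smul_eq_mul]
  congr 1
  ext x
  ring

theorem hasFourierGrad_sin_phase (hL : 0 < L) (k : Fin d → ℤ) :
    HasFourierGrad L (fun x => Real.sin (phase L k x))
      fun x => Real.cos (phase L k x) • waveVec L k := by
  intro j l
  rw [← fourierCoef_fderiv hL (contDiff_sin_phase k) (isPeriodic_sin_phase hL k)]
  simp only [fderiv_sin_phase, waveVec, PiLp.smul_apply, smul_eq_mul]
  congr 1
  ext x
  ring

theorem derivSymbol_zero (j : Fin d) : derivSymbol L j 0 = 0 := by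
  simp [derivSymbol]

/-- Up to the nonzero factor `2π k_j / L`, the cosine is a partial derivative of the periodic sine,
and such a derivative has zero mean because the symbol vanishes at frequency zero. -/
theorem fourierCoef_cos_phase_zero (hL : 0 < L) {k : Fin d → ℤ} (hk : k ≠ 0) :
    fourierCoef L (fun x => Real.cos (phase L k x)) 0 = 0 := by
  obtain ⟨j, hj⟩ := Function.ne_iff.mp hk
  have h := hasFourierGrad_sin_phase hL k j 0
  simp only [waveVec, PiLp.smul_apply, smul_eq_mul, mul_comm (Real.cos _)] at h
  rw [fourierCoef_const_mul, derivSymbol_zero, zero_mul] at h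
  refine (mul_eq_zero.mp h).resolve_left ?_
  have : (k j : ℝ) ≠ 0 := by exact_mod_cast hj
  exact_mod_cast (by positivity : 2 * Real.pi / L * (k j : ℝ) ≠ 0)

theorem fourierCoef_sin_phase_zero (hL : 0 < L) {k : Fin d → ℤ} (hk : k ≠ 0) :
    fourierCoef L (fun x => Real.sin (phase L k x)) 0 = 0 := by
  obtain ⟨j, hj⟩ := Function.ne_iff.mp hk
  have h := hasFourierGrad_cos_phase hL k j 0
  have e : (fun x : Space d => (-Real.sin (phase L k x) • waveVec L k) j) =
      fun x => (-(2 * Real.pi / L * k j)) * Real.sin (phase L k x) := by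
    ext x
    simp only [waveVec, PiLp.smul_apply, smul_eq_mul]
    ring
  rw [e, fourierCoef_const_mul, derivSymbol_zero, zero_mul] at h
  refine (mul_eq_zero.mp h).resolve_left ?_
  have : (k j : ℝ) ≠ 0 := by exact_mod_cast hj
  exact_mod_cast neg_ne_zero.mpr (by positivity : 2 * Real.pi / L * (k j : ℝ) ≠ 0)

/-- A flux that satisfies the weak form of `∇·D = ρ` against all periodic gradients has divergence
`ρ`. -/
theorem hasFourierDiv_of_weak (hL : 0 < L) {D : Space d → Space d} {ρ : Space d → ℝ}
    (hD : MemLp D 2 (volume.restrict (cube d L))) (hρ : MemLp ρ 2 (volume.restrict (cube d L)))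
    (hρ0 : fourierCoef L ρ 0 = 0)
    (h : ∀ (v : Space d → ℝ) (w : Space d → Space d), MemLp v 2 (volume.restrict (cube d L)) →
        MemLp w 2 (volume.restrict (cube d L)) → HasFourierGrad L v w → fourierCoef L v 0 = 0 →
        ∫ x in cube d L, inner ℝ (D x) (w x) = -∫ x in cube d L, ρ x * v x) :
    HasFourierDiv L D ρ := by
  intro k
  by_cases hk : k = 0
  -- Frequency zero cannot be tested with functions of zero mean; there the claim is the solvability
  -- condition `hρ0`.
  · simp [hk, derivSymbol_zero, hρ0]
  have hc := h _ (fun x => -Real.sin (phase L k x) • waveVec L k)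
    (memLp_of_continuous (contDiff_cos_phase k).continuous)
    (memLp_of_continuous (((contDiff_sin_phase k).continuous.neg).smul continuous_const))
    (hasFourierGrad_cos_phase hL k) (fourierCoef_cos_phase_zero hL hk)
  have hs := h _ (fun x => Real.cos (phase L k x) • waveVec L k)
    (memLp_of_continuous (contDiff_sin_phase k).continuous)
    (memLp_of_continuous ((contDiff_cos_phase k).continuous.smul continuous_const))
    (hasFourierGrad_sin_phase hL k) (fourierCoef_sin_phase_zero hL hk)
  have hW : IntegrableOn (fun x => inner ℝ (D x) (waveVec L k)) (cube d L) :=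
    (MemLp.integrableOn_cube hD).inner_const _
  have e : ∑ j, derivSymbol L j k * fourierCoef L (fun x => D x j) k =
      Complex.I * fourierCoef L (fun x => inner ℝ (D x) (waveVec L k)) k := by
    simp only [inner_eq_sum_mul, waveVec, mul_comm (D _ _)]
    rw [fourierCoef_sum, Finset.mul_sum]
    · refine Finset.sum_congr rfl fun j _ => ?_
      rw [fourierCoef_const_mul, derivSymbol, mul_assoc]
    · exact fun j _ => (MemLp.integrableOn_cube (memLp_coord hD j)).const_mul _
  simp only [inner_smul_right, neg_mul, integral_neg, mul_comm (Real.sin _),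
    mul_comm (Real.cos _), neg_inj] at hc hs
  rw [e, fourierCoef_eq hW, fourierCoef_eq (MemLp.integrableOn_cube hρ), hc, hs]
  push_cast
  linear_combination (-(∫ x in cube d L, ρ x * Real.cos (phase L k x) : ℝ) : ℂ) * Complex.I_sq

end FluxDivergence

/-! ### Weighted quadratic forms and the two energies. -/

section WeightedEnergy

/-- The bilinear form `∫_Ω w g·h dx`. -/
noncomputable def weightedInner (L : ℝ) (w : Space d → ℝ) (g h : Space d → Space d) : ℝ :=
  ∫ x in cube d L, w x * inner ℝ (g x) (h x)

theorem memLp_weight_smul {w : Space d → ℝ} (hw : MemLp w ⊤ (volume.restrict (cube d L)))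
    {g : Space d → Space d} (hg : MemLp g 2 (volume.restrict (cube d L))) :
    MemLp (fun x => w x • g x) 2 (volume.restrict (cube d L)) :=
  MemLp.smul hg hw

theorem integrableOn_weight_inner {w : Space d → ℝ} (hw : MemLp w ⊤ (volume.restrict (cube d L)))
    {g h : Space d → Space d} (hg : MemLp g 2 (volume.restrict (cube d L)))
    (hh : MemLp h 2 (volume.restrict (cube d L))) :
    IntegrableOn (fun x => w x * inner ℝ (g x) (h x)) (cube d L) := by
  have hwg := memLp_weight_smul hw hg
  refine (L2.integrable_inner (𝕜 := ℝ) (hwg.toLp _) (hh.toLp _)).congr ?_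
  filter_upwards [hwg.coeFn_toLp, hh.coeFn_toLp] with x h1 h2
  rw [h1, h2, real_inner_smul_left]

theorem weightedInner_congr {w : Space d → ℝ} {g g' h h' : Space d → Space d}
    (hg : g =ᵐ[volume.restrict (cube d L)] g') (hh : h =ᵐ[volume.restrict (cube d L)] h') :
    weightedInner L w g h = weightedInner L w g' h' := by
  refine integral_congr_ae ?_
  filter_upwards [hg, hh] with x h1 h2
  rw [h1, h2]

theorem weightedInner_add_smul_left {w : Space d → ℝ}
    (hw : MemLp w ⊤ (volume.restrict (cube d L))) {f g h : Space d → Space d}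
    (hf : MemLp f 2 (volume.restrict (cube d L))) (hg : MemLp g 2 (volume.restrict (cube d L)))
    (hh : MemLp h 2 (volume.restrict (cube d L))) (c : ℝ) :
    weightedInner L w (fun x => f x + c • g x) h =
      weightedInner L w f h + c * weightedInner L w g h := by
  simp only [weightedInner, inner_add_left, real_inner_smul_left, mul_add, mul_left_comm _ c]
  rw [integral_add (integrableOn_weight_inner hw hf hh)
    ((integrableOn_weight_inner hw hg hh).const_mul c), integral_const_mul]

theorem weightedInner_comm (w : Space d → ℝ) (g h : Space d → Space d) :
    weightedInner L w g h = weightedInner L w h g := by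
  simp only [weightedInner, real_inner_comm]

theorem weightedInner_add_smul_self {w : Space d → ℝ}
    (hw : MemLp w ⊤ (volume.restrict (cube d L))) {g h : Space d → Space d}
    (hg : MemLp g 2 (volume.restrict (cube d L))) (hh : MemLp h 2 (volume.restrict (cube d L)))
    (c : ℝ) :
    weightedInner L w (fun x => g x + c • h x) (fun x => g x + c • h x) =
      weightedInner L w g g + 2 * c * weightedInner L w g h + c ^ 2 * weightedInner L w h h := by
  have hgh : MemLp (fun x => g x + c • h x) 2 (volume.restrict (cube d L)) :=
    hg.add (hh.const_smul c)
  rw [weightedInner_add_smul_left hw hg hh hgh, weightedInner_comm w g,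
    weightedInner_comm w h, weightedInner_add_smul_left hw hg hh hg,
    weightedInner_add_smul_left hw hg hh hh, weightedInner_comm w h g]
  ring

theorem weightedInner_self_nonneg {w : Space d → ℝ}
    (hw : ∀ᵐ x ∂volume.restrict (cube d L), 0 < w x) (g : Space d → Space d) :
    0 ≤ weightedInner L w g g := by
  refine integral_nonneg_of_ae ?_
  filter_upwards [hw] with x hx
  exact mul_nonneg hx.le real_inner_self_nonneg

theorem ae_eq_zero_of_weightedInner_self {w : Space d → ℝ}
    (hw : MemLp w ⊤ (volume.restrict (cube d L)))
    (hwpos : ∀ᵐ x ∂volume.restrict (cube d L), 0 < w x) {g : Space d → Space d}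
    (hg : MemLp g 2 (volume.restrict (cube d L))) (h : weightedInner L w g g ≤ 0) :
    ∀ᵐ x ∂volume.restrict (cube d L), g x = 0 := by
  have h0 := h.antisymm (weightedInner_self_nonneg hwpos g)
  have hnn : 0 ≤ᵐ[volume.restrict (cube d L)] fun x => w x * inner ℝ (g x) (g x) := by
    filter_upwards [hwpos] with x hx
    exact mul_nonneg hx.le real_inner_self_nonneg
  have := (integral_eq_zero_iff_of_nonneg_ae hnn (integrableOn_weight_inner hw hg hg)).mp h0
  filter_upwards [this, hwpos] with x h1 h2
  exact inner_self_eq_zero.mp ((mul_eq_zero.mp h1).resolve_left h2.ne')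

theorem poissonEnergy_eq (ε : Space d → ℝ) (D : Space d → Space d) :
    poissonEnergy L ε D = weightedInner L (fun x => 1 / ε x) D D / 2 := by
  rw [poissonEnergy, weightedInner, div_eq_mul_inv, mul_comm, ← integral_const_mul]
  refine integral_congr_ae (Eventually.of_forall fun x => ?_)
  simp only [real_inner_self_eq_norm_sq, one_div, mul_inv]
  ring

theorem dirichletEnergy_eq {ε ρ φ : Space d → ℝ} (hε : MemLp ε ⊤ (volume.restrict (cube d L)))
    (hρ : MemLp ρ 2 (volume.restrict (cube d L))) (hφ : MemLp φ 2 (volume.restrict (cube d L)))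
    (hg : MemLp (weakGrad φ) 2 (volume.restrict (cube d L))) :
    dirichletEnergy L ε ρ φ = weightedInner L ε (weakGrad φ) (weakGrad φ) / 2 -
      ∫ x in cube d L, ρ x * φ x := by
  have e : ∀ x, ε x / 2 * ‖weakGrad φ x‖ ^ 2 =
      2⁻¹ * (ε x * inner ℝ (weakGrad φ x) (weakGrad φ x)) := by
    intro x
    rw [real_inner_self_eq_norm_sq]
    ring
  simp only [dirichletEnergy, e]
  rw [integral_sub ((integrableOn_weight_inner hε hg hg).const_mul _) (integrableOn_mul hρ hφ),
    integral_const_mul, weightedInner, inv_mul_eq_div]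

end WeightedEnergy

/-! ### The Dirichlet minimizer and the weak solution. -/

section PoissonEquation

variable {ε ρ : Space d → ℝ} {φ φ' : Space d → ℝ}

theorem sub_mem_H1PerZero (hL : 0 < L) (hφ' : φ' ∈ H1PerZero d L) (hφ : φ ∈ H1PerZero d L) :
    (fun x => φ' x + -1 * φ x) ∈ H1PerZero d L ∧ weakGrad (fun x => φ' x + -1 * φ x)
      =ᵐ[volume.restrict (cube d L)] fun x => weakGrad φ' x + (-1 : ℝ) • weakGrad φ x := by
  obtain ⟨h1, h2, h3, h4⟩ := H1PerZero_props hL hφ'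
  obtain ⟨k1, k2, k3, k4⟩ := H1PerZero_props hL hφ
  have k2' : MemLp (fun x => (-1 : ℝ) • weakGrad φ x) 2 (volume.restrict (cube d L)) :=
    k2.const_smul (-1 : ℝ)
  refine (h3.add (k3.const_mul (-1)) h1 (k1.const_mul _) h2 k2').mem_H1PerZero hL
    (fun x i => ?_) (h1.add (k1.const_mul _)) (h2.add k2') ?_
  · simp only [hφ'.1.1.1 x i, hφ.1.1.1 x i]
  · rw [fourierCoef_add (MemLp.integrableOn_cube h1) (MemLp.integrableOn_cube (k1.const_mul _)),
      fourierCoef_const_mul, h4, k4, mul_zero, add_zero]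

/-- Expand the quadratic form around `φ`. The weak equation tested with the difference `φ' - φ`
cancels the cross term against the linear term. -/
theorem IsWeakSolution.dirichletEnergy_eq_add (hL : 0 < L)
    (hε : MemLp ε ⊤ (volume.restrict (cube d L))) (hρ : MemLp ρ 2 (volume.restrict (cube d L)))
    (hφ : IsWeakSolution L ε ρ φ) (hφ' : φ' ∈ H1PerZero d L) :
    dirichletEnergy L ε ρ φ' = dirichletEnergy L ε ρ φ +
      weightedInner L ε (weakGrad fun x => φ' x + -1 * φ x)
        (weakGrad fun x => φ' x + -1 * φ x) / 2 := by
  obtain ⟨hξ, hgrad⟩ := sub_mem_H1PerZero hL hφ' hφ.1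
  obtain ⟨h1, h2, h3, h4⟩ := H1PerZero_props hL hφ'
  obtain ⟨k1, k2, k3, k4⟩ := H1PerZero_props hL hφ.1
  obtain ⟨l1, l2, -, -⟩ := H1PerZero_props hL hξ
  have key : weightedInner L ε (weakGrad φ) (weakGrad fun x => φ' x + -1 * φ x) =
      ∫ x in cube d L, ρ x * (φ' x + -1 * φ x) := hφ.2 _ hξ
  have e1 : ∫ x in cube d L, ρ x * (φ' x + -1 * φ x) =
      (∫ x in cube d L, ρ x * φ' x) - ∫ x in cube d L, ρ x * φ x := by
    rw [← integral_sub (integrableOn_mul hρ h1) (integrableOn_mul hρ k1)]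
    refine integral_congr_ae (Eventually.of_forall fun x => ?_)
    ring
  have e2 : weightedInner L ε (weakGrad φ') (weakGrad φ') =
      weightedInner L ε (fun x => weakGrad φ x +
      (1 : ℝ) • weakGrad (fun x => φ' x + -1 * φ x) x) (fun x => weakGrad φ x +
      (1 : ℝ) • weakGrad (fun x => φ' x + -1 * φ x) x) := by
    have : weakGrad φ' =ᵐ[volume.restrict (cube d L)] fun x => weakGrad φ x +
      (1 : ℝ) • weakGrad (fun x => φ' x + -1 * φ x) x := by
      filter_upwards [hgrad] with x hx
      rw [hx]
      module
    exact weightedInner_congr this this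
  rw [dirichletEnergy_eq hε hρ h1 h2, dirichletEnergy_eq hε hρ k1 k2, e2,
    weightedInner_add_smul_self hε k2 l2, key, e1]
  ring

theorem IsWeakSolution.isMinOn (hL : 0 < L) (hε : MemLp ε ⊤ (volume.restrict (cube d L)))
    (hεpos : ∀ᵐ x ∂volume.restrict (cube d L), 0 < ε x)
    (hρ : MemLp ρ 2 (volume.restrict (cube d L))) (hφ : IsWeakSolution L ε ρ φ) :
    IsMinOn (dirichletEnergy L ε ρ) (H1PerZero d L) φ := by
  refine isMinOn_iff.mpr fun φ' hφ' => ?_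
  rw [hφ.dirichletEnergy_eq_add hL hε hρ hφ']
  linarith [weightedInner_self_nonneg hεpos (weakGrad fun x => φ' x + -1 * φ x)]

/-- Equal energies force the gradient of the difference to vanish, Poincaré makes the difference
zero in the cube, and periodicity extends this to the whole space. -/
theorem IsWeakSolution.ae_eq_of_isMinOn (hL : 0 < L)
    (hε : MemLp ε ⊤ (volume.restrict (cube d L)))
    (hεpos : ∀ᵐ x ∂volume.restrict (cube d L), 0 < ε x)
    (hρ : MemLp ρ 2 (volume.restrict (cube d L))) (hφ : IsWeakSolution L ε ρ φ)
    (hφ' : φ' ∈ H1PerZero d L) (hmin : IsMinOn (dirichletEnergy L ε ρ) (H1PerZero d L) φ') :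
    φ' =ᵐ[volume] φ := by
  have h1 := isMinOn_iff.mp hmin φ hφ.1
  rw [hφ.dirichletEnergy_eq_add hL hε hρ hφ'] at h1
  obtain ⟨hξ, -⟩ := sub_mem_H1PerZero hL hφ' hφ.1
  obtain ⟨l1, l2, l3, l4⟩ := H1PerZero_props hL hξ
  have h2 := ae_eq_zero_of_weightedInner_self hε hεpos l2 (by linarith)
  have h3 := l3.poincare hL l4 l1 l2
  have h4 : ∫ x in cube d L, ‖weakGrad (fun x => φ' x + -1 * φ x) x‖ ^ 2 = 0 := by
    refine (integral_congr_ae ?_).trans (integral_zero _ _)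
    filter_upwards [h2] with x hx
    rw [hx, norm_zero, zero_pow two_ne_zero]
  rw [h4] at h3
  have hpos : 0 < (2 * Real.pi / L) ^ 2 := by positivity
  have h5 : ∫ x in cube d L, (φ' x + -1 * φ x) ^ 2 = 0 :=
    le_antisymm (nonpos_of_mul_nonpos_right h3 hpos) (integral_nonneg fun x => sq_nonneg _)
  have h6 := (integral_eq_zero_iff_of_nonneg (fun x => sq_nonneg _) l1.integrable_sq).mp h5
  refine hφ'.1.1.1.aePeriodic.ae_eq_of_ae_eq_cube hL hφ.1.1.1.1.aePeriodic ?_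
  filter_upwards [h6] with x hx
  have : φ' x + -1 * φ x = 0 := pow_eq_zero_iff (two_ne_zero) |>.mp hx
  linarith

theorem exists_isWeakSolution (hL : 0 < L) {εmin : ℝ} (hεmin : 0 < εmin)
    (hε : MemLp ε ⊤ (volume.restrict (cube d L)))
    (hεbd : ∀ᵐ x ∂volume.restrict (cube d L), εmin ≤ ε x)
    (hρ : MemLp ρ 2 (volume.restrict (cube d L))) : ∃ φ, IsWeakSolution L ε ρ φ := by
  obtain ⟨u, g, hu, hg, hug, hu0, h⟩ := exists_weak_solution hL hεmin hε hεbd hρ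
  have huw := comp_wrap_ae_eq hL u
  obtain ⟨hmem, hgrad⟩ := (hug.congr huw.symm (EventuallyEq.refl _ g)).mem_H1PerZero hL
    (isPeriodic_comp_wrap hL u) (hu.ae_eq huw.symm) hg ((fourierCoef_congr huw 0).trans hu0)
  refine ⟨_, hmem, fun ξ hξ => ?_⟩
  obtain ⟨h1, h2, h3, h4⟩ := H1PerZero_props hL hξ
  rw [← h ξ (weakGrad ξ) h1 h2 h3 h4]
  exact weightedInner_congr hgrad (EventuallyEq.refl _ _)

end PoissonEquation

/-! ### Minimization over the Gauss-law set and the flux. -/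

section GaussLaw

variable {ε ρ : Space d → ℝ} {w : Space d → ℝ} {D D' : Space d → Space d}

theorem add_smul_mem_gaussSet (hL : 0 < L) {r s : Space d → ℝ}
    (hr : MemLp r 2 (volume.restrict (cube d L))) (hs : MemLp s 2 (volume.restrict (cube d L)))
    (hD : D ∈ gaussSet d L r) (hD' : D' ∈ gaussSet d L s) (c : ℝ) :
    (fun x => D x + c • D' x) ∈ gaussSet d L fun x => r x + c * s x := by
  rw [mem_gaussSet_iff hL hr] at hD
  rw [mem_gaussSet_iff hL hs] at hD'
  have hrs : MemLp (fun x => r x + c * s x) 2 (volume.restrict (cube d L)) :=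
    hr.add (hs.const_mul c)
  exact (mem_gaussSet_iff hL hrs).mpr ⟨hD.1.add (hD'.1.const_smul c),
    hD.2.add_const_smul hD'.2 hD.1 hD'.1 hr hs c⟩

theorem sub_mem_gaussSet_zero (hL : 0 < L) (hρ : MemLp ρ 2 (volume.restrict (cube d L)))
    (hD : D ∈ gaussSet d L ρ) (hD' : D' ∈ gaussSet d L ρ) :
    (fun x => D x + (-1 : ℝ) • D' x) ∈ gaussSet d L fun _ => 0 := by
  simpa using add_smul_mem_gaussSet hL hρ hρ hD hD' (-1)

theorem mem_gaussSet_add_smul (hL : 0 < L) (hρ : MemLp ρ 2 (volume.restrict (cube d L)))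
    (hD : D ∈ gaussSet d L ρ) (hD' : D' ∈ gaussSet d L fun _ => 0) (c : ℝ) :
    (fun x => D x + c • D' x) ∈ gaussSet d L ρ := by
  simpa using add_smul_mem_gaussSet hL hρ (memLp_const 0) hD hD' c

/-- Along `D + t D'` with `D'` divergence-free the energy changes by `t a + t² b / 2`. Minimality
forces `a = 0`; conversely, with `a = 0` every competitor adds a nonnegative square. -/
theorem isMinOn_poissonEnergy_iff (hL : 0 < L)
    (hw : MemLp (fun x => 1 / ε x) ⊤ (volume.restrict (cube d L)))
    (hwpos : ∀ᵐ x ∂volume.restrict (cube d L), 0 < 1 / ε x)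
    (hρ : MemLp ρ 2 (volume.restrict (cube d L))) (hD : D ∈ gaussSet d L ρ) :
    IsMinOn (poissonEnergy L ε) (gaussSet d L ρ) D ↔
      ∀ D' ∈ gaussSet d L (fun _ => 0), weightedInner L (fun x => 1 / ε x) D D' = 0 := by
  rw [isMinOn_iff]
  constructor
  · intro h D' hD'
    set a := weightedInner L (fun x => 1 / ε x) D D'
    set b := weightedInner L (fun x => 1 / ε x) D' D'
    have hb : 0 ≤ b := weightedInner_self_nonneg hwpos D'
    have key : ∀ t : ℝ, 0 ≤ 2 * t * a + t ^ 2 * b := by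
      intro t
      have h1 := h _ (mem_gaussSet_add_smul hL hρ hD hD' t)
      rw [poissonEnergy_eq, poissonEnergy_eq, weightedInner_add_smul_self hw hD.1.1 hD'.1.1] at h1
      linarith
    -- The optimal `t` would be `-a / b`; using `b + 1` covers `b = 0` and still makes the
    -- expression negative unless `a = 0`.
    have h2 := key (-a / (b + 1))
    have h3 : 2 * (-a / (b + 1)) * a + (-a / (b + 1)) ^ 2 * b =
        -(a ^ 2 * ((b + 2) / (b + 1) ^ 2)) := by
      field_simp
      ring
    rw [h3] at h2
    have h4 : 0 < (b + 2) / (b + 1) ^ 2 := by positivity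
    have h5 : a ^ 2 ≤ 0 := nonpos_of_mul_nonpos_left (by linarith) h4
    exact pow_eq_zero_iff two_ne_zero |>.mp (le_antisymm h5 (sq_nonneg a))
  · intro h E hE
    have hsub := sub_mem_gaussSet_zero hL hρ hE hD
    have e : E = fun x => D x + (1 : ℝ) • (E x + (-1 : ℝ) • D x) := by
      ext1 x
      module
    rw [poissonEnergy_eq, poissonEnergy_eq]
    conv_rhs => rw [e]
    rw [weightedInner_add_smul_self hw hD.1.1 hsub.1.1, h _ hsub]
    linarith [weightedInner_self_nonneg hwpos fun x => E x + (-1 : ℝ) • D x]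

/-- The difference `D - D'` is divergence-free and orthogonal to every such field, hence to itself.
-/
theorem ae_eq_of_orthogonal (hL : 0 < L) (hw : MemLp w ⊤ (volume.restrict (cube d L)))
    (hwpos : ∀ᵐ x ∂volume.restrict (cube d L), 0 < w x)
    (hρ : MemLp ρ 2 (volume.restrict (cube d L))) (hD : D ∈ gaussSet d L ρ)
    (hD' : D' ∈ gaussSet d L ρ)
    (h : ∀ E ∈ gaussSet d L (fun _ => 0), weightedInner L w D E = 0)
    (h' : ∀ E ∈ gaussSet d L (fun _ => 0), weightedInner L w D' E = 0) :
    D =ᵐ[volume.restrict (cube d L)] D' := by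
  have hsub := sub_mem_gaussSet_zero hL hρ hD hD'
  have h0 : weightedInner L w (fun x => D x + (-1 : ℝ) • D' x)
      (fun x => D x + (-1 : ℝ) • D' x) = 0 := by
    rw [weightedInner_add_smul_left hw hD.1.1 hD'.1.1 hsub.1.1, h _ hsub, h' _ hsub]
    ring
  filter_upwards [ae_eq_zero_of_weightedInner_self hw hwpos hsub.1.1 h0.le] with x hx
  rw [neg_one_smul, ← sub_eq_add_neg] at hx
  exact sub_eq_zero.mp hx

theorem IsWeakSolution.flux_mem_gaussSet (hL : 0 < L) {φ : Space d → ℝ}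
    (hε : MemLp ε ⊤ (volume.restrict (cube d L))) (hρ : MemLp ρ 2 (volume.restrict (cube d L)))
    (hρ0 : fourierCoef L ρ 0 = 0) (hφ : IsWeakSolution L ε ρ φ) :
    (fun x => -(ε x • weakGrad φ x)) ∈ gaussSet d L ρ := by
  obtain ⟨-, hg, -, -⟩ := H1PerZero_props hL hφ.1
  have hD : MemLp (fun x => -(ε x • weakGrad φ x)) 2 (volume.restrict (cube d L)) :=
    (memLp_weight_smul hε hg).neg
  refine (mem_gaussSet_iff hL hρ).mpr ⟨hD, hasFourierDiv_of_weak hL hD hρ hρ0 ?_⟩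
  intro v h hv hh hvh hv0
  have hvw := comp_wrap_ae_eq hL v
  obtain ⟨hmem, hgrad⟩ := (hvh.congr hvw.symm (EventuallyEq.refl _ h)).mem_H1PerZero hL
    (isPeriodic_comp_wrap hL v) (hv.ae_eq hvw.symm) hh ((fourierCoef_congr hvw 0).trans hv0)
  have key := hφ.2 _ hmem
  simp only [inner_neg_left, real_inner_smul_left, integral_neg, neg_inj]
  refine (weightedInner_congr (EventuallyEq.refl _ _) hgrad.symm).trans (key.trans ?_)
  refine integral_congr_ae ?_
  filter_upwards [hvw] with x hx
  rw [hx]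

/-- The weight `1 / ε` cancels the factor `ε`, leaving the integral of `∇φ · D`, which vanishes by
Green's identity. -/
theorem flux_orthogonal (hL : 0 < L) {φ : Space d → ℝ} (hφ : φ ∈ H1PerZero d L)
    (hεpos : ∀ᵐ x ∂volume.restrict (cube d L), 0 < ε x) (hD : D ∈ gaussSet d L fun _ => 0) :
    weightedInner L (fun x => 1 / ε x) (fun x => -(ε x • weakGrad φ x)) D = 0 := by
  obtain ⟨h1, h2, h3, -⟩ := H1PerZero_props hL hφ
  have hz : MemLp (fun _ : Space d => (0 : ℝ)) 2 (volume.restrict (cube d L)) := memLp_const 0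
  obtain ⟨hD2, hdiv⟩ := (mem_gaussSet_iff hL hz).mp hD
  have key := h3.setIntegral_inner hL hdiv h1 h2 hD2 hz
  simp only [mul_zero, integral_zero, neg_zero] at key
  rw [weightedInner, ← neg_eq_zero, ← integral_neg, ← key]
  refine integral_congr_ae ?_
  filter_upwards [hεpos] with x hx
  rw [inner_neg_left, real_inner_smul_left]
  field_simp

end GaussLaw
end PoissonEnergy

/-! ### The main theorem. -/

open PoissonEnergy
theorem theoremt (d : ℕ) (hd : d = 2 ∨ d = 3) (L : ℝ) (hL : 0 < L)
    (ε ρ : Space d → ℝ) (εmin εmax : ℝ)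
    (hε : ε ∈ LpPer d L ⊤) (hεmin : 0 < εmin)
    (hεbd : ∀ᵐ x : Space d, εmin ≤ ε x ∧ ε x ≤ εmax)
    (hρ : ρ ∈ LpPerZero d L 2) :
    ∃ (φmin : Space d → ℝ) (Dmin : Space d → Space d),
      -- (1) `φmin` is the unique minimizer of `I`, and the unique weak solution
      ((φmin ∈ H1PerZero d L ∧ IsMinOn (dirichletEnergy L ε ρ) (H1PerZero d L) φmin) ∧
        (∀ φ ∈ H1PerZero d L, IsMinOn (dirichletEnergy L ε ρ) (H1PerZero d L) φ →
          φ =ᵐ[volume] φmin) ∧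
        IsWeakSolution L ε ρ φmin ∧
        (∀ φ, IsWeakSolution L ε ρ φ → φ =ᵐ[volume] φmin)) ∧
      -- (2) `Dmin` is the unique minimizer of `F`, and minimizers are characterized by orthogonality
      ((Dmin ∈ gaussSet d L ρ ∧ IsMinOn (poissonEnergy L ε) (gaussSet d L ρ) Dmin) ∧
        (∀ D ∈ gaussSet d L ρ, IsMinOn (poissonEnergy L ε) (gaussSet d L ρ) D →
          D =ᵐ[volume.restrict (cube d L)] Dmin) ∧
        (∀ D : Space d → Space d,
          (D ∈ gaussSet d L ρ ∧ IsMinOn (poissonEnergy L ε) (gaussSet d L ρ) D) ↔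
          (D ∈ gaussSet d L ρ ∧ ∀ D' ∈ gaussSet d L (fun _ => 0),
            ∫ x in cube d L, 1 / ε x * inner ℝ (D x) (D' x) = 0))) ∧
      -- (3) `Dmin = -ε ∇φmin`
      Dmin =ᵐ[volume.restrict (cube d L)] fun x => -(ε x • weakGrad φmin x) := by
  have hε' := hε.2
  have hρ2 := hρ.1.2
  have hρ0 := (setAverage_eq_zero_iff hL).mp hρ.2
  have hbd := ae_restrict_of_ae (s := cube d L) hεbd
  have hεpos : ∀ᵐ x ∂volume.restrict (cube d L), 0 < ε x := by
    filter_upwards [hbd] with x hx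
    exact hεmin.trans_le hx.1
  have hwpos : ∀ᵐ x ∂volume.restrict (cube d L), 0 < 1 / ε x := by
    filter_upwards [hεpos] with x hx
    exact one_div_pos.mpr hx
  have hw : MemLp (fun x => 1 / ε x) ⊤ (volume.restrict (cube d L)) := by
    refine memLp_top_of_bound (hε'.aestronglyMeasurable.aemeasurable.const_div
      1).aestronglyMeasurable (1 / εmin) ?_
    filter_upwards [hbd, hwpos] with x hx hx'
    rw [Real.norm_of_nonneg hx'.le]
    exact one_div_le_one_div_of_le hεmin hx.1
  obtain ⟨φ, hφ⟩ := exists_isWeakSolution hL hεmin hε' (hbd.mono fun x hx => hx.1) hρ2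
  have hflux := hφ.flux_mem_gaussSet hL hε' hρ2 hρ0
  have horth := fun D' (hD' : D' ∈ gaussSet d L fun _ => 0) =>
    flux_orthogonal hL hφ.1 hεpos hD'
  have hiff := fun D (hD : D ∈ gaussSet d L ρ) => isMinOn_poissonEnergy_iff hL hw hwpos hρ2 hD
  -- The flux itself is the witness for `Dmin`, so (3) holds by reflexivity and (2) reduces to the
  -- orthogonality criterion.
  refine ⟨φ, fun x => -(ε x • weakGrad φ x), ⟨⟨hφ.1, hφ.isMinOn hL hε' hεpos hρ2⟩, ?_, hφ, ?_⟩,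
    ⟨⟨hflux, (hiff _ hflux).mpr horth⟩, ?_, ?_⟩, EventuallyEq.refl _ _⟩
  · exact fun φ' hφ' hmin => hφ.ae_eq_of_isMinOn hL hε' hεpos hρ2 hφ' hmin
  -- Another weak solution is also a minimizer, so uniqueness of minimizers applies.
  · exact fun φ' hφ' =>
      hφ.ae_eq_of_isMinOn hL hε' hεpos hρ2 hφ'.1 (hφ'.isMinOn hL hε' hεpos hρ2)
  · exact fun D hD hmin =>
      ae_eq_of_orthogonal hL hw hwpos hρ2 hD hflux ((hiff D hD).mp hmin) horth
  · exact fun D => and_congr_right fun hD => hiff D hD
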